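/- **Definitions.** A *type* is a sequence $\{(m_k,n_{k+1},r_{k+1})\}_{k\in\omega}\subseteq\omega^3$ such that $m_0=1$; $n_k\ge 2$ for all $k\ge 1$; for every $r\in\omega$ there are infinitely many $k\geq 1$ with $r_k=r$; and $m_k>r_{k+1}$, $m_{k+1}=r_{k+1}+(m_k-r_{k+1})n_{k+1}$ for all $k\in\omega$. A *construction scheme over $\omega_1$* of this type is a family $\mathcal F\subseteq[\omega_1]^{<\omega}$ such that, with $\mathcal F_k$ denoting the set of elements of rank $k$ in the well-founded order $(\mathcal F,\subsetneq)$: (1) every finite subset of $\omega_1$ is contained in a member of $\mathcal F$; (2) $|F|=m_k$ for $F\in\mathcal F_k$; (3) if $E,F\in\mathcal F_k$ then $E\cap F$ is an initial segment of $E$ and of $F$; (4) every $F\in\mathcal F_{k+1}$ is the union of a unique family $\{F_i\}_{i<n_{k+1}}$ of $n_{k+1}$ members of $\mathcal F_k$ (the canonical decomposition), and this family is a $\Delta$-system with a root $R(F)$ of cardinality $r_{k+1}$ such that $R(F)<F_0\setminus R(F)<\dots<F_{n_{k+1}-1}\setminus R(F)$. $F\in\mathcal F_l$ ($l\ge1$)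 *fully captures* $\{c_i\}_{i<n_l}\subseteq[\omega_1]^{<\omega}$ if for each $i<n_l$ we have $c_i\subseteq F_i$, $c_i\setminus R(F)\neq\emptyset$ and $\phi_i[c_0]=c_i$, where $\phi_i:F_0\to F_i$ is the increasing bijection. $\mathcal F$ is *fully capturing* if for every uncountable $S\subseteq[\omega_1]^{<\omega}$ and every $k\in\omega$ there are a finite $\mathcal C\subseteq S$, some $l>k$ and $F\in\mathcal F_l$ that fully captures $\mathcal C$. The axiom *FCA* says that for every type there is a fully capturing construction scheme over $\omega_1$ of that type. Let $X$ be a countably infinite set. Write $A\subseteq^*B$ if $A\setminus B$ is finite, and $A\subsetneq^*B$ if $A\subseteq^*B$ but not $B\subseteq^*A$. An *$\omega_1$-pretower* on $X$ is a family of infinite subsets of $X$, indexed by a well-ordered set of order type $\omega_1$ and strictly increasing with respect to $\subsetneq^*$. Let $\mathcal A=\{A_\alpha\}_{\alpha\in I}$ and $\mathcal B=\{B_\alpha\}_{\alpha\in I}$ be $\omega_1$-pretowers with a common index set $I$. The pair $(\mathcal A,\mathcal B)$ is an *$(\omega_1,\omega_1)$-gap* if $A_\alpha\cap B_\alpha=\emptyset$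 for all $\alpha\in I$ and there is no $C\subseteq X$ with $A_\alpha\subseteq^*C$ and $B_\alpha\subseteq^*X\setminus C$ for all $\alpha\in I$. Define $$\chi_0(\mathcal A,\mathcal B)=\Big\{\sigma\in[I]^{<\omega}: \Big(\bigcup_{\alpha\in\sigma}A_\alpha\Big)\cap\Big(\bigcup_{\alpha\in\sigma}B_\alpha\Big)=\emptyset\Big\},$$ $$\chi_1(\mathcal A,\mathcal B)=\big\{\sigma\in[I]^{<\omega}: (A_\alpha\cap B_\beta)\cup(A_\beta\cap B_\alpha)\ne\emptyset\text{ for all distinct }\alpha,\beta\in\sigma\big\},$$ both ordered by reverse inclusion. A family $\{(\mathcal A_j,\mathcal B_j)\}_{j\in J}$ of $(\omega_1,\omega_1)$-gaps is *independent* if for every finite $\mathcal C\subseteq J$ and every $s:\mathcal C\to 2$ the product $\prod_{c\in\mathcal C}\chi_{s(c)}(\mathcal A_c,\mathcal B_c)$ is ccc (every set of pairwise incompatible elements is countable). A *coherent family of functions supported by an $\omega_1$-pretower* $\{T_\alpha\}_{\alpha\in\omega_1\setminus\omega}$ is a family of functions $f_\alpha:T_\alpha\to\alpha$ ($\alpha\in\omega_1\setminus\omega$)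 such that $\{x\in T_\alpha\cap T_\beta: f_\alpha(x)\neq f_\beta(x)\}$ is finite for all $\alpha<\beta$. For $\xi<\mu$ in $\omega_1\setminus\omega$ let $\mathcal A^\xi=\{f_\alpha^{-1}[\{\xi\}]\}_{\mu<\alpha<\omega_1}$ and $\mathcal A^\mu=\{f_\alpha^{-1}[\{\mu\}]\}_{\mu<\alpha<\omega_1}$. The coherent family is *independent* if the pairs $(\mathcal A^\xi,\mathcal A^\mu)$, $\xi<\mu$ in $\omega_1\setminus\omega$, are $(\omega_1,\omega_1)$-gaps and form an independent family of gaps. **Theorem [FCA].** Assume FCA. On every countably infinite set $X$ there is an independent coherent family of functions $\{f_\alpha\}_{\alpha\in\omega_1\setminus\omega}$ supported by an $\omega_1$-pretower on $X$. In particular, any subfamily of the gaps can be frozen or filled independently in the following sense: for every $e:[\omega_1\setminus\omega]^2\to2$ the finite support product of the forcing notions $\chi_{e(\{\xi,\mu\})}(\mathcal A^\xi,\mathcal A^\mu)$, over all $\xi<\mu$ in $\omega_1\setminus\omega$, is ccc. -/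

import Mathlib

open scoped Ordinal

/-! ### Construction schemes and the Fully Capturing Axiom -/

/-- The set `ω₁` of all countable ordinals. -/
abbrev Omega1 : Type 1 := Set.Iio (ω₁ : Ordinal.{0})

/-- A type `{(m_k, n_{k+1}, r_{k+1})}_{k ∈ ω}`. The values `n 0` and `r 0` are not part of the type
and are never used. -/
structure SchemeType where
  m : ℕ → ℕ
  n : ℕ → ℕ
  r : ℕ → ℕ
  m_zero : m 0 = 1
  two_le_n : ∀ k, 1 ≤ k → 2 ≤ n k
  r_infinite : ∀ a : ℕ, {k : ℕ | 1 ≤ k ∧ r k = a}.Infinite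
  r_lt_m : ∀ k, r (k + 1) < m k
  m_succ : ∀ k, m (k + 1) = r (k + 1) + (m k - r (k + 1)) * n (k + 1)

section Schemes

variable {Ω : Type*} [LinearOrder Ω]

/-- `C ⊑ D`: the set `C` is an initial segment of `D`. -/
def InitialSegment (C D : Finset Ω) : Prop :=
  C ⊆ D ∧ ∀ c ∈ C, ∀ d ∈ D, d ≤ c → d ∈ C

/-- `A < B`: every element of `A` is below every element of `B`. -/
def BlockLT (A B : Finset Ω) : Prop :=
  ∀ a ∈ A, ∀ b ∈ B, a < b

/-- `𝓕_k`: the elements of `𝓕` whose rank in the well-founded order `(𝓕, ⊊)` is `k`. -/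
def schemeLevel (𝓕 : Set (Finset Ω)) (k : ℕ) : Set (Finset Ω) :=
  {F | ∃ h : F ∈ 𝓕, IsWellFounded.rank (fun A B : 𝓕 => (A : Finset Ω) ⊂ (B : Finset Ω)) ⟨F, h⟩ = k}

/-- `D 0, …, D (n_{k+1} - 1)` are members of `𝓕_k` with union `F`. -/
def IsDecomposition (τ : SchemeType) (𝓕 : Set (Finset Ω)) (k : ℕ) (F : Finset Ω)
    (D : ℕ → Finset Ω) : Prop :=
  (∀ i < τ.n (k + 1), D i ∈ schemeLevel 𝓕 k) ∧ F = (Finset.range (τ.n (k + 1))).biUnion D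

/-- `D 0, …, D (n_{k+1} - 1)` is the canonical decomposition of `F ∈ 𝓕_{k+1}`, with root `R`:
a `Δ`-system with root `R` of cardinality `r_{k+1}`, and
`R < D 0 \ R < ⋯ < D (n_{k+1} - 1) \ R`. -/
def IsCanonicalDecomposition (τ : SchemeType) (𝓕 : Set (Finset Ω)) (k : ℕ) (F : Finset Ω)
    (D : ℕ → Finset Ω) (R : Finset Ω) : Prop :=
  IsDecomposition τ 𝓕 k F D ∧
  (∀ i < τ.n (k + 1), ∀ j < τ.n (k + 1), i ≠ j → D i ∩ D j = R) ∧
  R.card = τ.r (k + 1) ∧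
  (∀ i < τ.n (k + 1), BlockLT R (D i \ R)) ∧
  (∀ i < τ.n (k + 1), ∀ j < τ.n (k + 1), i < j → BlockLT (D i \ R) (D j \ R))

/-- `𝓕` is a construction scheme over `Ω` of type `τ`. In `decomposition`, the set
`{D i | i < n_{k+1}}` is the only family of `n_{k+1}` members of `𝓕_k` with union `F`. -/
structure IsConstructionScheme (τ : SchemeType) (𝓕 : Set (Finset Ω)) : Prop where
  cofinal : ∀ A : Finset Ω, ∃ F ∈ 𝓕, A ⊆ F
  card_eq : ∀ k, ∀ F ∈ schemeLevel 𝓕 k, F.card = τ.m k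
  inter : ∀ k, ∀ F ∈ schemeLevel 𝓕 k, ∀ E ∈ schemeLevel 𝓕 k,
    InitialSegment (E ∩ F) E ∧ InitialSegment (E ∩ F) F
  decomposition : ∀ k, ∀ F ∈ schemeLevel 𝓕 (k + 1), ∃ D R,
    IsCanonicalDecomposition τ 𝓕 k F D R ∧
    ∀ E, IsDecomposition τ 𝓕 k F E →
      (Finset.range (τ.n (k + 1))).image E = (Finset.range (τ.n (k + 1))).image D

/-- `F ∈ 𝓕_{k+1}` fully captures `C = {c 0, …, c (n_{k+1} - 1)}`. The map `φ` is the increasing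
bijection from `D 0` to `D i`, and it sends `c 0` onto `c i`. -/
def FullyCaptures (τ : SchemeType) (𝓕 : Set (Finset Ω)) (k : ℕ) (F : Finset Ω)
    (C : Finset (Finset Ω)) : Prop :=
  ∃ (D : ℕ → Finset Ω) (R : Finset Ω) (c : ℕ → Finset Ω),
    IsCanonicalDecomposition τ 𝓕 k F D R ∧
    C = (Finset.range (τ.n (k + 1))).image c ∧
    ∀ i < τ.n (k + 1), c i ⊆ D i ∧ (c i \ R).Nonempty ∧
      ∃ φ : ↥(D 0) ≃o ↥(D i), ∀ x : ↥(D 0), (φ x : Ω) ∈ c i ↔ (x : Ω) ∈ c 0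

/-- `𝓕` is fully capturing: every uncountable family of finite sets has, at arbitrarily high
levels, a finite subfamily that is fully captured by a member of `𝓕` of that level. -/
def IsFullyCapturing (τ : SchemeType) (𝓕 : Set (Finset Ω)) : Prop :=
  ∀ S : Set (Finset Ω), ¬ S.Countable → ∀ k₀ : ℕ,
    ∃ (C : Finset (Finset Ω)) (k : ℕ), (C : Set (Finset Ω)) ⊆ S ∧ k₀ < k + 1 ∧
      ∃ F ∈ schemeLevel 𝓕 (k + 1), FullyCaptures τ 𝓕 k F C

end Schemes

/-- The Fully Capturing Axiom: there is a fully capturing construction scheme over `ω₁` of every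
possible type. -/
def FCA : Prop :=
  ∀ τ : SchemeType, ∃ 𝓕 : Set (Finset Omega1), IsConstructionScheme τ 𝓕 ∧ IsFullyCapturing τ 𝓕

/-! ### Pretowers and gaps -/

section Gaps

variable {X : Type*}

/-- `A ⊆* B`. -/
def AlmostSubset (A B : Set X) : Prop := (A \ B).Finite

/-- `A ⊊* B`: `A ⊆* B` and not `A =* B`. -/
def AlmostSSubset (A B : Set X) : Prop :=
  AlmostSubset A B ∧ ¬ (AlmostSubset A B ∧ AlmostSubset B A)

/-- The family `T`, indexed in an order preserving way by `ι`, is a `κ`-pretower on `X`. -/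
structure IsPretower (κ : Ordinal.{0}) {ι : Type*} [LinearOrder ι] (T : ι → Set X) : Prop where
  orderType : Nonempty (ι ≃o Set.Iio κ)
  infinite : ∀ i, (T i).Infinite
  increasing : ∀ i j, i < j → AlmostSSubset (T i) (T j)

/-- `(A, B)` is an `(ω₁, ω₁)`-pregap. The pretowers have a common index set, so that `A i` and `B j`
have the same rank if and only if `i = j`. -/
structure IsPregap {ι : Type*} [LinearOrder ι] (A B : ι → Set X) : Prop where
  left : IsPretower ω₁ A
  right : IsPretower ω₁ B
  inter_eq_empty : ∀ i, A i ∩ B i = ∅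

/-- `(A, B)` is an `(ω₁, ω₁)`-gap. -/
structure IsGap {ι : Type*} [LinearOrder ι] (A B : ι → Set X) : Prop where
  pregap : IsPregap A B
  not_separated : ¬ ∃ C : Set X, ∀ i, AlmostSubset (A i) C ∧ AlmostSubset (B i) Cᶜ

/-- The conditions of the forcing notion `χ₀(A, B)`. -/
def chiZero {ι : Type*} (A B : ι → Set X) : Set (Finset ι) :=
  {σ | (⋃ a ∈ σ, A a) ∩ (⋃ a ∈ σ, B a) = ∅}

/-- The conditions of the forcing notion `χ₁(A, B)`. -/
def chiOne {ι : Type*} (A B : ι → Set X) : Set (Finset ι) :=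
  {σ | ∀ a ∈ σ, ∀ b ∈ σ, a ≠ b → ((A a ∩ B b) ∪ (A b ∩ B a)).Nonempty}

/-- The forcing notion `χ_e(A, B)`, `e ∈ {0, 1}`, ordered by reverse inclusion. -/
abbrev Chi {ι : Type*} (e : Fin 2) (A B : ι → Set X) : Type _ :=
  (↥(if e = 0 then chiZero A B else chiOne A B))ᵒᵈ

/-- The finite set of indices underlying a condition of `χ_e(A, B)`. -/
def Chi.support {ι : Type*} {e : Fin 2} {A B : ι → Set X} (p : Chi e A B) : Finset ι :=
  (OrderDual.ofDual p).1

/-- A forcing notion is ccc if its antichains (sets of pairwise incompatible elements) are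
countable. -/
def IsCCC (P : Type*) [Preorder P] : Prop :=
  ∀ S : Set P, (∀ p ∈ S, ∀ q ∈ S, p ≠ q → ¬ ∃ r, r ≤ p ∧ r ≤ q) → S.Countable

/-- The family of gaps `(A j, B j)`, `j ∈ J`, is independent. The product carries the
coordinatewise order. -/
structure IsIndependentGaps {J : Type*} {ι : J → Type*} [∀ j, LinearOrder (ι j)]
    (A B : ∀ j, ι j → Set X) : Prop where
  gap : ∀ j, IsGap (A j) (B j)
  ccc : ∀ (C : Finset J) (s : C → Fin 2), IsCCC (∀ c : C, Chi (s c) (A c) (B c))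

/-- The finite support product of the forcing notions `χ_{e(j)}(A j, B j)`, `j ∈ J`, with the
coordinatewise order: all but finitely many coordinates are the largest condition `∅`. -/
abbrev FiniteSupportProduct {J : Type*} {ι : J → Type*} (e : J → Fin 2)
    (A B : ∀ j, ι j → Set X) : Type _ :=
  {p : ∀ j, Chi (e j) (A j) (B j) // {j | Chi.support (p j) ≠ ∅}.Finite}

end Gaps

/-! ### Coherent families of functions -/

/-- The index set `ω₁ \ ω`. -/
abbrev Omega1Tail : Type 1 := Set.Ico (ω : Ordinal.{0}) ω₁

section Coherent

variable {X : Type*}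

/-- The functions `f α : T α → α`, `α ∈ ω₁ \ ω`, form a coherent family of functions supported by
the `ω₁`-pretower `T`. -/
structure IsCoherentFamily (T : Omega1Tail → Set X)
    (f : ∀ α : Omega1Tail, T α → Set.Iio (α : Ordinal.{0})) : Prop where
  pretower : IsPretower ω₁ T
  coherent : ∀ α β : Omega1Tail, α < β →
    {x : X | ∃ (hα : x ∈ T α) (hβ : x ∈ T β),
      (f α ⟨x, hα⟩ : Ordinal.{0}) ≠ (f β ⟨x, hβ⟩ : Ordinal.{0})}.Finite

/-- `A^ξ_α = f_α⁻¹[{ξ}]`. -/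
def fiber {T : Omega1Tail → Set X} (f : ∀ α : Omega1Tail, T α → Set.Iio (α : Ordinal.{0}))
    (ξ α : Omega1Tail) : Set X :=
  {x : X | ∃ h : x ∈ T α, (f α ⟨x, h⟩ : Ordinal.{0}) = ξ}

/-- The set `[ω₁ \ ω]²` of pairs `c(0) < c(1)`. -/
abbrev TailPair : Type 1 := {c : Omega1Tail × Omega1Tail // c.1 < c.2}

/-- The family `𝒜^{c(0)}` on the index set `{α | c(1) < α < ω₁}`, where the fibers over both members
of `c` are defined. -/
def lowerFibers {T : Omega1Tail → Set X} (f : ∀ α : Omega1Tail, T α → Set.Iio (α : Ordinal.{0}))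
    (c : TailPair) : Set.Ioi c.1.2 → Set X :=
  fun α => fiber f c.1.1 α

/-- The family `𝒜^{c(1)}` on the index set `{α | c(1) < α < ω₁}`. -/
def upperFibers {T : Omega1Tail → Set X} (f : ∀ α : Omega1Tail, T α → Set.Iio (α : Ordinal.{0}))
    (c : TailPair) : Set.Ioi c.1.2 → Set X :=
  fun α => fiber f c.1.2 α

/-- The coherent family `f` is independent: the gaps `(𝒜^{c(0)}, 𝒜^{c(1)})`, `c ∈ [ω₁ \ ω]²`, are
independent. -/
def IsIndependentFamily {T : Omega1Tail → Set X}
    (f : ∀ α : Omega1Tail, T α → Set.Iio (α : Ordinal.{0})) : Prop :=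
  IsIndependentGaps (lowerFibers f) (upperFibers f)

end Coherent

/-! ### Levels, positions and nearness in a construction scheme. -/

section SchemeCombinatorics

/-! FCA is used for a single type, `pairingType`, in which a member of level `k` has `2 * 2 ^ (r k *
r k)` blocks: one pair of blocks for every binary relation on its root. Members of one level meet in
initial segments, so every ordinal has a well-defined position at each level. A point of the
countable set is a level together with a coded partial function on positions. The function with
index `α` takes the value `ξ` there when `ξ` and `α` share a member of that level and the code sends
the position of `α` to that of `ξ`.

The codes `inl (g, d)`, constantly `g` from position `d` on, make the fibers strictly increasing.
The codes `inr (ε, a, b)` are `a` on block `2ε` and `b` on block `2ε + 1`, and are active only if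
the relation `ε` relates `a` to `b`. If `α ≤ β` share a member of level `k`, then above level `k`
the function of `β` extends that of `α`; only finitely many points in the domain of the latter
remain below. This is coherence (`schemeFiber_mono`, `exists_finite_schemeFiber_subset`).

For the chain conditions, a condition is a finite set of triples `(ξ, μ, α)`. Among uncountably many
of one isomorphism type, the supports are captured by a member `F` of some level `l + 1` with root
`R`. The restriction of `e` to `R` is coded by some `ε`, and the conditions captured in the blocks
`2ε` and `2ε + 1` are compatible (`pairGood_cross`). A pair `(ξ, μ)` occurring in both lies in `R`.
Up to level `l` an index looks like its copy in the other block. At level `l + 1` indices from the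
two blocks, outside the root, conflict exactly when `e ξ μ ≠ 0`. Above, they cannot conflict, since
they share `F`. All pairs are treated at once, which gives the finite support product; singletons
with `e = 1` give nonseparation. -/

theorem SchemeType.m_lt_m_succ (τ : SchemeType) (k : ℕ) : τ.m k < τ.m (k + 1) := by
  rw [τ.m_succ]
  have h1 := τ.r_lt_m k
  have h2 := τ.two_le_n (k + 1) (by omega)
  obtain ⟨d, hd⟩ := Nat.exists_eq_add_of_lt h1
  have h3 : τ.m k - τ.r (k + 1) = d + 1 := by omega
  rw [h3]
  nlinarith [Nat.mul_le_mul_left (d + 1) h2]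

theorem SchemeType.m_strictMono (τ : SchemeType) : StrictMono τ.m :=
  strictMono_nat_of_lt_succ τ.m_lt_m_succ

variable {Ω : Type*} [LinearOrder Ω] {τ : SchemeType} {𝓕 : Set (Finset Ω)}

-- Proper inclusion increases cardinality. Hence all ranks are finite, and the levels indexed by `ℕ`
-- exhaust the scheme.
omit [LinearOrder Ω] in
theorem scheme_rank_le_card (F : 𝓕) :
    IsWellFounded.rank (fun A B : 𝓕 => (A : Finset Ω) ⊂ (B : Finset Ω)) F ≤ F.1.card := by
  induction hn : F.1.card using Nat.strong_induction_on generalizing F with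
  | _ n ih =>
    rw [IsWellFounded.rank_eq]
    refine Ordinal.iSup_le fun G => ?_
    have hlt := Finset.card_lt_card G.2
    refine Order.succ_le_of_lt ((ih _ (hn ▸ hlt) G.1 rfl).trans_lt ?_)
    exact_mod_cast hn ▸ hlt

omit [LinearOrder Ω] in
theorem exists_mem_schemeLevel {F : Finset Ω} (hF : F ∈ 𝓕) : ∃ k, F ∈ schemeLevel 𝓕 k := by
  have h := scheme_rank_le_card (⟨F, hF⟩ : 𝓕)
  obtain ⟨k, hk⟩ := Ordinal.lt_omega0.1 (h.trans_lt (Ordinal.natCast_lt_omega0 _))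
  exact ⟨k, hF, hk⟩

/-- `α` and `β` lie in a common member of `𝓕_k`. -/
def Near (𝓕 : Set (Finset Ω)) (k : ℕ) (α β : Ω) : Prop :=
  ∃ F ∈ schemeLevel 𝓕 k, α ∈ F ∧ β ∈ F

/-- The position of `α` in any member of `𝓕_k` containing it. -/
noncomputable def schemePos (𝓕 : Set (Finset Ω)) (k : ℕ) (α : Ω) : ℕ :=
  sInf {p | ∃ F ∈ schemeLevel 𝓕 k, α ∈ F ∧ (F.filter (· < α)).card = p}

/-- The index of the block to which the position `p` of a member of `𝓕_{l+1}` belongs, for `p`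
outside the root. -/
def schemeBlock (τ : SchemeType) (l p : ℕ) : ℕ :=
  (p - τ.r (l + 1)) / (τ.m l - τ.r (l + 1))

omit [LinearOrder Ω] in
theorem Near.symm {k : ℕ} {α β : Ω} (h : Near 𝓕 k α β) : Near 𝓕 k β α := by
  obtain ⟨F, hF, ha, hb⟩ := h
  exact ⟨F, hF, hb, ha⟩

namespace IsConstructionScheme

variable (h : IsConstructionScheme τ 𝓕)
include h

theorem exists_superset (A : Finset Ω) : ∃ k, ∃ F ∈ schemeLevel 𝓕 k, A ⊆ F := by
  obtain ⟨F, hF, hA⟩ := h.cofinal A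
  obtain ⟨k, hk⟩ := exists_mem_schemeLevel hF
  exact ⟨k, F, hk, hA⟩

theorem mem_of_le {k : ℕ} {E F : Finset Ω} (hE : E ∈ schemeLevel 𝓕 k)
    (hF : F ∈ schemeLevel 𝓕 k) {α β : Ω} (hβE : β ∈ E) (hβF : β ∈ F) (hαE : α ∈ E)
    (hle : α ≤ β) : α ∈ F := by
  have := (h.inter k F hF E hE).1.2 β (by simp [hβE, hβF]) α hαE hle
  exact (Finset.mem_inter.1 this).2

/-- This is what makes `schemePos` independent of the member used to compute it. -/
theorem filter_lt_eq {k : ℕ} {E F : Finset Ω} (hE : E ∈ schemeLevel 𝓕 k)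
    (hF : F ∈ schemeLevel 𝓕 k) {α : Ω} (hαE : α ∈ E) (hαF : α ∈ F) :
    E.filter (· < α) = F.filter (· < α) := by
  ext x
  simp only [Finset.mem_filter]
  exact ⟨fun hx => ⟨h.mem_of_le hE hF hαE hαF hx.1 hx.2.le, hx.2⟩,
    fun hx => ⟨h.mem_of_le hF hE hαF hαE hx.1 hx.2.le, hx.2⟩⟩

theorem schemePos_eq {k : ℕ} {F : Finset Ω} (hF : F ∈ schemeLevel 𝓕 k) {α : Ω} (hα : α ∈ F) :
    schemePos 𝓕 k α = (F.filter (· < α)).card := by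
  have : {p | ∃ F ∈ schemeLevel 𝓕 k, α ∈ F ∧ (F.filter (· < α)).card = p} =
      {(F.filter (· < α)).card} := by
    ext p
    simp only [Set.mem_ofPred_eq, Set.mem_singleton_iff]
    constructor
    · rintro ⟨E, hE, hαE, rfl⟩
      rw [h.filter_lt_eq hE hF hαE hα]
    · rintro rfl
      exact ⟨F, hF, hα, rfl⟩
  rw [schemePos, this, csInf_singleton]

theorem schemePos_lt_schemePos {k : ℕ} {α β : Ω} (hn : Near 𝓕 k α β) (hlt : α < β) :
    schemePos 𝓕 k α < schemePos 𝓕 k β := by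
  obtain ⟨F, hF, ha, hb⟩ := hn
  rw [h.schemePos_eq hF ha, h.schemePos_eq hF hb]
  refine Finset.card_lt_card ((Finset.ssubset_iff_of_subset ?_).2 ⟨α, by simp [ha, hlt], by simp⟩)
  intro x hx
  simp only [Finset.mem_filter] at hx ⊢
  exact ⟨hx.1, hx.2.trans hlt⟩

theorem eq_of_schemePos_eq {k : ℕ} {α β : Ω} (hn : Near 𝓕 k α β)
    (heq : schemePos 𝓕 k α = schemePos 𝓕 k β) : α = β := by
  rcases lt_trichotomy α β with hlt | hlt | hlt
  · exact absurd heq (h.schemePos_lt_schemePos hn hlt).ne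
  · exact hlt
  · exact absurd heq (h.schemePos_lt_schemePos hn.symm hlt).ne'

theorem schemePos_lt_m {k : ℕ} {F : Finset Ω} (hF : F ∈ schemeLevel 𝓕 k) {α : Ω} (hα : α ∈ F) :
    schemePos 𝓕 k α < τ.m k := by
  rw [h.schemePos_eq hF hα, ← h.card_eq k F hF]
  exact Finset.card_lt_card ((Finset.ssubset_iff_of_subset (Finset.filter_subset _ _)).2
    ⟨α, hα, by simp⟩)

/-- By the initial segment property, a member containing `α` absorbs everything below `α` that is
near `α` at the same level. -/
theorem near_trans {k : ℕ} {ξ α β : Ω} (h1 : Near 𝓕 k ξ α) (h2 : Near 𝓕 k α β) (hle : ξ ≤ α) :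
    Near 𝓕 k ξ β := by
  obtain ⟨E, hE, hξ, hα⟩ := h1
  obtain ⟨F, hF, hα', hβ⟩ := h2
  exact ⟨F, hF, h.mem_of_le hE hF hα hα' hξ hle, hβ⟩

theorem exists_mem_of_succ {k : ℕ} {F : Finset Ω} (hF : F ∈ schemeLevel 𝓕 (k + 1)) {α : Ω}
    (hα : α ∈ F) : ∃ E ∈ schemeLevel 𝓕 k, E ⊆ F ∧ α ∈ E := by
  obtain ⟨D, R, hD, -⟩ := h.decomposition k F hF
  rw [hD.1.2, Finset.mem_biUnion] at hα
  obtain ⟨i, hi, hα⟩ := hα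
  refine ⟨D i, hD.1.1 i (Finset.mem_range.1 hi), ?_, hα⟩
  rw [hD.1.2]
  exact Finset.subset_biUnion_of_mem D hi

theorem exists_mem_of_le {k l : ℕ} (hkl : k ≤ l) {α : Ω} :
    (∃ F ∈ schemeLevel 𝓕 l, α ∈ F) → ∃ E ∈ schemeLevel 𝓕 k, α ∈ E := by
  induction l, hkl using Nat.le_induction with
  | base => exact id
  | succ l hl ih =>
    rintro ⟨F, hF, hα⟩
    obtain ⟨E, hE, -, hαE⟩ := h.exists_mem_of_succ hF hα
    exact ih ⟨E, hE, hαE⟩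

/-- A member containing `α` and at least `m k` elements has level at least `k`; descend from it
through canonical decompositions. -/
theorem exists_mem [Infinite Ω] (k : ℕ) (α : Ω) : ∃ F ∈ schemeLevel 𝓕 k, α ∈ F := by
  obtain ⟨A, hA⟩ := Infinite.exists_subset_card_eq Ω (τ.m k)
  obtain ⟨l, F, hF, hAF⟩ := h.exists_superset (insert α A)
  refine h.exists_mem_of_le (l := l) ?_ ⟨F, hF, hAF (by simp)⟩
  rw [← τ.m_strictMono.le_iff_le, ← hA, ← h.card_eq l F hF]
  exact Finset.card_le_card fun x hx => hAF (by simp [hx])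

theorem near_succ [Infinite Ω] {k : ℕ} {α β : Ω} (hn : Near 𝓕 k α β) : Near 𝓕 (k + 1) α β := by
  wlog hle : α ≤ β generalizing α β
  · exact (this hn.symm (le_of_not_ge hle)).symm
  obtain ⟨F, hF, hα, hβ⟩ := hn
  obtain ⟨G, hG, hβG⟩ := h.exists_mem (k + 1) β
  obtain ⟨E, hE, hEG, hβE⟩ := h.exists_mem_of_succ hG hβG
  exact ⟨G, hG, hEG (h.mem_of_le hF hE hβ hβE hα hle), hβG⟩

theorem near_mono [Infinite Ω] {k l : ℕ} (hkl : k ≤ l) {α β : Ω} (hn : Near 𝓕 k α β) :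
    Near 𝓕 l α β := by
  induction l, hkl using Nat.le_induction with
  | base => exact hn
  | succ l hl ih => exact h.near_succ ih

theorem exists_near [Infinite Ω] (A : Finset Ω) :
    ∃ K, ∀ k ≥ K, ∀ α ∈ A, ∀ β ∈ A, Near 𝓕 k α β := by
  obtain ⟨K, F, hF, hA⟩ := h.exists_superset A
  exact ⟨K, fun k hk α hα β hβ => h.near_mono hk ⟨F, hF, hA hα, hA hβ⟩⟩

/-! ### Positions relative to the canonical decomposition. -/

section Decomposition

omit h in
theorem _root_.IsCanonicalDecomposition.root_subset {l : ℕ} {F R : Finset Ω} {D : ℕ → Finset Ω}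
    (hD : IsCanonicalDecomposition τ 𝓕 l F D R) {i : ℕ} (hi : i < τ.n (l + 1)) : R ⊆ D i := by
  have hn := τ.two_le_n (l + 1) (by omega)
  obtain ⟨j, hj, hij⟩ : ∃ j < τ.n (l + 1), i ≠ j := by
    rcases Nat.eq_zero_or_pos i with rfl | hi'
    · exact ⟨1, by omega, by omega⟩
    · exact ⟨0, by omega, by omega⟩
  rw [← hD.2.1 i hi j hj hij]
  exact Finset.inter_subset_left

omit h in
theorem _root_.IsCanonicalDecomposition.subset {l : ℕ} {F R : Finset Ω} {D : ℕ → Finset Ω}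
    (hD : IsCanonicalDecomposition τ 𝓕 l F D R) {i : ℕ} (hi : i < τ.n (l + 1)) : D i ⊆ F := by
  rw [hD.1.2]
  exact Finset.subset_biUnion_of_mem D (Finset.mem_range.2 hi)

variable {l : ℕ} {F R : Finset Ω} {D : ℕ → Finset Ω}

theorem schemePos_root (hF : F ∈ schemeLevel 𝓕 (l + 1))
    (hD : IsCanonicalDecomposition τ 𝓕 l F D R) {α : Ω} (hα : α ∈ R) :
    schemePos 𝓕 (l + 1) α = schemePos 𝓕 l α ∧ schemePos 𝓕 l α < τ.r (l + 1) := by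
  have h0 : 0 < τ.n (l + 1) := by have := τ.two_le_n (l + 1) (by omega); omega
  have hR := hD.root_subset h0
  have key : ∀ x ∈ F, x < α → x ∈ R := by
    intro x hx hxα
    rw [hD.1.2, Finset.mem_biUnion] at hx
    obtain ⟨i, hi, hx⟩ := hx
    by_contra hxR
    exact absurd hxα (hD.2.2.2.1 i (Finset.mem_range.1 hi) α hα x (by simp [hx, hxR])).not_gt
  rw [h.schemePos_eq hF (hD.subset h0 (hR hα)), h.schemePos_eq (hD.1.1 0 h0) (hR hα)]
  have e1 : F.filter (· < α) = R.filter (· < α) := by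
    ext x
    simp only [Finset.mem_filter]
    exact ⟨fun hx => ⟨key x hx.1 hx.2, hx.2⟩, fun hx => ⟨hD.subset h0 (hR hx.1), hx.2⟩⟩
  have e2 : (D 0).filter (· < α) = R.filter (· < α) := by
    ext x
    simp only [Finset.mem_filter]
    exact ⟨fun hx => ⟨key x (hD.subset h0 hx.1) hx.2, hx.2⟩, fun hx => ⟨hR hx.1, hx.2⟩⟩
  rw [e1, e2, ← hD.2.2.1]
  exact ⟨rfl, Finset.card_lt_card ((Finset.ssubset_iff_of_subset (Finset.filter_subset _ _)).2
    ⟨α, hα, by simp⟩)⟩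

/-- The predecessors of `α` in `F` are the first `i` blocks with the root removed, followed by its
predecessors in `D i`. -/
theorem schemePos_block (hF : F ∈ schemeLevel 𝓕 (l + 1))
    (hD : IsCanonicalDecomposition τ 𝓕 l F D R) {i : ℕ} (hi : i < τ.n (l + 1)) {α : Ω}
    (hα : α ∈ D i) (hαR : α ∉ R) :
    schemePos 𝓕 (l + 1) α = i * (τ.m l - τ.r (l + 1)) + schemePos 𝓕 l α ∧
      τ.r (l + 1) ≤ schemePos 𝓕 l α := by
  have hR := hD.root_subset hi
  have hαD : α ∈ D i \ R := by simp [hα, hαR]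
  rw [h.schemePos_eq hF (hD.subset hi hα), h.schemePos_eq (hD.1.1 i hi) hα]
  have e1 : F.filter (· < α) =
      (Finset.range i).biUnion (fun j => D j \ R) ∪ (D i).filter (· < α) := by
    ext x
    simp only [Finset.mem_filter, Finset.mem_union, Finset.mem_biUnion, Finset.mem_range]
    constructor
    · rintro ⟨hx, hxα⟩
      rw [hD.1.2, Finset.mem_biUnion] at hx
      obtain ⟨j, hj, hx⟩ := hx
      rw [Finset.mem_range] at hj
      by_cases hxR : x ∈ R
      · exact Or.inr ⟨hR hxR, hxα⟩
      · have hxD : x ∈ D j \ R := by simp [hx, hxR]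
        rcases lt_trichotomy i j with hij | rfl | hij
        · exact absurd hxα (hD.2.2.2.2 i hi j hj hij α hαD x hxD).not_gt
        · exact Or.inr ⟨hx, hxα⟩
        · exact Or.inl ⟨j, hij, hxD⟩
    · rintro (⟨j, hj, hx⟩ | ⟨hx, hxα⟩)
      · exact ⟨hD.subset (hj.trans hi) (Finset.mem_sdiff.1 hx).1,
          hD.2.2.2.2 j (hj.trans hi) i hi hj x hx α hαD⟩
      · exact ⟨hD.subset hi hx, hxα⟩
  have e2 : Disjoint ((Finset.range i).biUnion (fun j => D j \ R)) ((D i).filter (· < α)) := by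
    rw [Finset.disjoint_left]
    intro x hx hx'
    simp only [Finset.mem_filter, Finset.mem_biUnion, Finset.mem_range, Finset.mem_sdiff] at hx hx'
    obtain ⟨j, hj, hxj, hxR⟩ := hx
    rw [← hD.2.1 j (hj.trans hi) i hi hj.ne] at hxR
    exact hxR (Finset.mem_inter.2 ⟨hxj, hx'.1⟩)
  have e3 : ((Finset.range i).biUnion (fun j => D j \ R)).card =
      i * (τ.m l - τ.r (l + 1)) := by
    rw [Finset.card_biUnion, Finset.sum_congr rfl (g := fun _ => τ.m l - τ.r (l + 1))]
    · simp
    · intro j hj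
      have hj' := (Finset.mem_range.1 hj).trans hi
      rw [Finset.card_sdiff_of_subset (hD.root_subset hj'), hD.2.2.1,
        h.card_eq l _ (hD.1.1 j hj')]
    · intro a ha b hb hab
      refine Finset.disjoint_left.2 ?_
      intro x hx hx'
      simp only [Finset.mem_sdiff] at hx hx'
      apply hx.2
      rw [← hD.2.1 a ((Finset.mem_range.1 ha).trans hi) b ((Finset.mem_range.1 hb).trans hi) hab]
      exact Finset.mem_inter.2 ⟨hx.1, hx'.1⟩
  refine ⟨by rw [e1, Finset.card_union_of_disjoint e2, e3], ?_⟩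
  rw [← hD.2.2.1]
  refine Finset.card_le_card fun x hx => ?_
  exact Finset.mem_filter.2 ⟨hR hx, hD.2.2.2.1 i hi x hx α hαD⟩

theorem schemeBlock_eq (hF : F ∈ schemeLevel 𝓕 (l + 1))
    (hD : IsCanonicalDecomposition τ 𝓕 l F D R) {i : ℕ} (hi : i < τ.n (l + 1)) {α : Ω}
    (hα : α ∈ D i) (hαR : α ∉ R) :
    schemeBlock τ l (schemePos 𝓕 (l + 1) α) = i ∧ τ.r (l + 1) ≤ schemePos 𝓕 (l + 1) α := by
  obtain ⟨h1, h2⟩ := h.schemePos_block hF hD hi hα hαR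
  have h3 := h.schemePos_lt_m (hD.1.1 i hi) hα
  have h4 := τ.r_lt_m l
  refine ⟨?_, by omega⟩
  rw [schemeBlock, h1, Nat.add_sub_assoc h2, Nat.mul_comm, Nat.mul_add_div (by omega),
    Nat.div_eq_of_lt (by omega), add_zero]

theorem mem_root_iff (hF : F ∈ schemeLevel 𝓕 (l + 1))
    (hD : IsCanonicalDecomposition τ 𝓕 l F D R) {α : Ω} (hα : α ∈ F) :
    α ∈ R ↔ schemePos 𝓕 (l + 1) α < τ.r (l + 1) := by
  constructor
  · intro hαR
    obtain ⟨h1, h2⟩ := h.schemePos_root hF hD hαR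
    omega
  · intro hlt
    by_contra hαR
    rw [hD.1.2, Finset.mem_biUnion] at hα
    obtain ⟨i, hi, hα⟩ := hα
    have := (h.schemeBlock_eq hF hD (Finset.mem_range.1 hi) hα hαR).2
    omega

/-- The position at level `l + 1` alone decides membership in the root and the index of the block,
and so the position one level down. -/
theorem root_or_block_of_schemePos_eq {F' R' : Finset Ω} {D' : ℕ → Finset Ω}
    (hF : F ∈ schemeLevel 𝓕 (l + 1)) (hD : IsCanonicalDecomposition τ 𝓕 l F D R)
    (hF' : F' ∈ schemeLevel 𝓕 (l + 1)) (hD' : IsCanonicalDecomposition τ 𝓕 l F' D' R')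
    {α α' : Ω} (hα : α ∈ F) (hα' : α' ∈ F')
    (heq : schemePos 𝓕 (l + 1) α = schemePos 𝓕 (l + 1) α') :
    schemePos 𝓕 l α = schemePos 𝓕 l α' ∧
      ((α ∈ R ∧ α' ∈ R') ∨
        ∃ i < τ.n (l + 1), (α ∈ D i ∧ α ∉ R) ∧ (α' ∈ D' i ∧ α' ∉ R')) := by
  have hiff : α ∈ R ↔ α' ∈ R' := by rw [h.mem_root_iff hF hD hα, h.mem_root_iff hF' hD' hα', heq]
  by_cases hαR : α ∈ R
  · have h1 := h.schemePos_root hF hD hαR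
    have h2 := h.schemePos_root hF' hD' (hiff.1 hαR)
    exact ⟨by omega, Or.inl ⟨hαR, hiff.1 hαR⟩⟩
  · have hαR' := fun hc => hαR (hiff.2 hc)
    rw [hD.1.2, Finset.mem_biUnion] at hα
    obtain ⟨i, hi, hα⟩ := hα
    rw [hD'.1.2, Finset.mem_biUnion] at hα'
    obtain ⟨j, hj, hα'⟩ := hα'
    rw [Finset.mem_range] at hi hj
    have hij : i = j := by
      rw [← (h.schemeBlock_eq hF hD hi hα hαR).1, ← (h.schemeBlock_eq hF' hD' hj hα' hαR').1, heq]
    subst hij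
    have h1 := h.schemePos_block hF hD hi hα hαR
    have h2 := h.schemePos_block hF' hD' hi hα' hαR'
    exact ⟨by omega, Or.inr ⟨i, hi, ⟨hα, hαR⟩, hα', hαR'⟩⟩

end Decomposition

variable [Infinite Ω]

theorem schemePos_eq_of_le {k l : ℕ} (hkl : k ≤ l) {α α' : Ω} :
    schemePos 𝓕 l α = schemePos 𝓕 l α' → schemePos 𝓕 k α = schemePos 𝓕 k α' := by
  induction l, hkl using Nat.le_induction with
  | base => exact id
  | succ l hl ih =>
    intro heq
    obtain ⟨F, hF, hα⟩ := h.exists_mem (l + 1) α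
    obtain ⟨F', hF', hα'⟩ := h.exists_mem (l + 1) α'
    obtain ⟨D, R, hD, -⟩ := h.decomposition l F hF
    obtain ⟨D', R', hD', -⟩ := h.decomposition l F' hF'
    exact ih (h.root_or_block_of_schemePos_eq hF hD hF' hD' hα hα' heq).1

-- For `ξ ≤ α` in a member of level `l + 1`, being near at level `l` means that `ξ` is in the root
-- or in the same block as `α`, and both can be read off the positions.
omit [Infinite Ω] in
theorem near_of_schemePos_eq_succ {l : ℕ} {ξ α ξ' α' : Ω} (hle : ξ ≤ α)
    (hn : Near 𝓕 (l + 1) ξ α) (hn' : Near 𝓕 (l + 1) ξ' α')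
    (hξ : schemePos 𝓕 (l + 1) ξ = schemePos 𝓕 (l + 1) ξ')
    (hα : schemePos 𝓕 (l + 1) α = schemePos 𝓕 (l + 1) α') (hl : Near 𝓕 l ξ α) :
    Near 𝓕 l ξ' α' := by
  obtain ⟨F, hF, hξF, hαF⟩ := hn
  obtain ⟨F', hF', hξF', hαF'⟩ := hn'
  obtain ⟨D, R, hD, -⟩ := h.decomposition l F hF
  obtain ⟨D', R', hD', -⟩ := h.decomposition l F' hF'
  obtain ⟨-, ⟨hξR, hξR'⟩ | ⟨i, hi, ⟨hξD, hξR⟩, hξD', hξR'⟩⟩ :=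
    h.root_or_block_of_schemePos_eq hF hD hF' hD' hξF hξF' hξ
  · rw [hD'.1.2, Finset.mem_biUnion] at hαF'
    obtain ⟨j, hj, hαj⟩ := hαF'
    rw [Finset.mem_range] at hj
    exact ⟨D' j, hD'.1.1 j hj, hD'.root_subset hj hξR', hαj⟩
  · obtain ⟨-, ⟨hαR, hαR'⟩ | ⟨j, hj, ⟨hαD, hαR⟩, hαD', hαR'⟩⟩ :=
      h.root_or_block_of_schemePos_eq hF hD hF' hD' hαF hαF' hα
    · exact absurd hle (hD.2.2.2.1 i hi α hαR ξ (by simp [hξD, hξR])).not_ge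
    · obtain ⟨H, hH, hξH, hαH⟩ := hl
      have hξj := h.mem_of_le hH (hD.1.1 j hj) hαH hαD hξH hle
      by_cases hij : i = j
      · subst hij
        exact ⟨D' i, hD'.1.1 i hi, hξD', hαD'⟩
      · exact absurd (hD.2.1 i hi j hj hij ▸ Finset.mem_inter.2 ⟨hξD, hξj⟩) hξR

theorem near_of_schemePos_eq {k l : ℕ} (hkl : k ≤ l) {ξ α ξ' α' : Ω} (hle : ξ ≤ α)
    (hk : Near 𝓕 k ξ α) : Near 𝓕 l ξ' α' → schemePos 𝓕 l ξ = schemePos 𝓕 l ξ' →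
    schemePos 𝓕 l α = schemePos 𝓕 l α' → Near 𝓕 k ξ' α' := by
  induction l, hkl using Nat.le_induction with
  | base => exact fun hn _ _ => hn
  | succ l hl ih =>
    intro hn hξ hα
    exact ih (h.near_of_schemePos_eq_succ hle (h.near_mono (by omega) hk) hn hξ hα
      (h.near_mono hl hk)) (h.schemePos_eq_of_le (Nat.le_succ l) hξ)
      (h.schemePos_eq_of_le (Nat.le_succ l) hα)

theorem schemeBlock_eq_of_near {l : ℕ} {α β : Ω} (hle : α ≤ β) (hn : Near 𝓕 l α β)
    (hr : τ.r (l + 1) ≤ schemePos 𝓕 (l + 1) α) :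
    schemeBlock τ l (schemePos 𝓕 (l + 1) α) = schemeBlock τ l (schemePos 𝓕 (l + 1) β) := by
  obtain ⟨F, hF, hαF, hβF⟩ := h.near_succ hn
  obtain ⟨D, R, hD, -⟩ := h.decomposition l F hF
  have hαR : α ∉ R := by rw [h.mem_root_iff hF hD hαF]; omega
  have hβR : β ∉ R := by
    rw [h.mem_root_iff hF hD hβF]
    rcases hle.eq_or_lt with rfl | hlt
    · omega
    · have := h.schemePos_lt_schemePos (h.near_succ hn) hlt
      omega
  rw [hD.1.2, Finset.mem_biUnion] at hβF
  obtain ⟨j, hj, hβj⟩ := hβF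
  rw [Finset.mem_range] at hj
  obtain ⟨H, hH, hαH, hβH⟩ := hn
  have hαj := h.mem_of_le hH (hD.1.1 j hj) hβH hβj hαH hle
  rw [(h.schemeBlock_eq hF hD hj hαj hαR).1, (h.schemeBlock_eq hF hD hj hβj hβR).1]

end IsConstructionScheme

end SchemeCombinatorics

/-! ### The type, the coded points and the fibers. -/

section SchemeFibers

/-- A type in which the blocks of each level come in pairs, one pair for each binary relation on
the root. -/
def pairingType : SchemeType :=
  -- Unpairing repeats each value infinitely often and keeps `r (k + 1) ≤ k`, which is below `m k`.
  let r : ℕ → ℕ := fun k => (Nat.unpair (k - 1)).1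
  let n : ℕ → ℕ := fun k => 2 * 2 ^ (r k * r k)
  let m : ℕ → ℕ := fun k => Nat.rec 1 (fun k a => r (k + 1) + (a - r (k + 1)) * n (k + 1)) k
  have hn : ∀ k, 2 ≤ n k := fun k => by
    have : 0 < 2 ^ (r k * r k) := by positivity
    show 2 ≤ 2 * 2 ^ (r k * r k)
    omega
  have hr : ∀ k, r (k + 1) ≤ k := fun k => Nat.unpair_left_le k
  have hm : ∀ k, k < m k := fun k => by
    induction k with
    | zero => exact Nat.one_pos
    | succ k ih =>
      show k + 1 < r (k + 1) + (m k - r (k + 1)) * n (k + 1)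
      have h1 := hr k
      have h2 := Nat.mul_le_mul_left (m k - r (k + 1)) (hn (k + 1))
      omega
  { m := m
    n := n
    r := r
    m_zero := rfl
    two_le_n := fun k _ => hn k
    r_infinite := fun a => by
      refine Set.infinite_of_injective_forall_mem (f := fun b => Nat.pair a b + 1) ?_ ?_
      · intro b c hbc
        simpa using hbc
      · intro b
        simp [r]
    r_lt_m := fun k => (hr k).trans_lt (hm k)
    m_succ := fun _ => rfl }

theorem pairingType_n (k : ℕ) :
    pairingType.n k = 2 * 2 ^ (pairingType.r k * pairingType.r k) := rfl

/-- The points of the set that supports the coherent family: a level and a code of a partial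
function on the positions of that level. -/
abbrev SchemePoint : Type := ℕ × ((ℕ × ℕ) ⊕ (ℕ × ℕ × ℕ))

/-- The partial function coded by a point of level `k` takes the value `q` at the position `p`. -/
def CodeRel (τ : SchemeType) (k : ℕ) : (ℕ × ℕ) ⊕ (ℕ × ℕ × ℕ) → ℕ → ℕ → Prop
  | .inl (g, d), p, q => q = g ∧ g < d ∧ d ≤ p
  | .inr (ε, a, b), p, q => ∃ l, k = l + 1 ∧ a < b ∧ b < τ.r k ∧ ε < 2 ^ (τ.r k * τ.r k) ∧
      ε.testBit (a * τ.r k + b) = true ∧ τ.r k ≤ p ∧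
      ((schemeBlock τ l p = 2 * ε ∧ q = a) ∨ (schemeBlock τ l p = 2 * ε + 1 ∧ q = b))

theorem CodeRel.lt {τ : SchemeType} {k : ℕ} {y : (ℕ × ℕ) ⊕ (ℕ × ℕ × ℕ)} {p q : ℕ}
    (h : CodeRel τ k y p q) : q < p := by
  rcases y with ⟨g, d⟩ | ⟨ε, a, b⟩
  · obtain ⟨h1, h2, h3⟩ := h
    omega
  · obtain ⟨l, -, h1, h2, -, -, h3, ⟨-, h4⟩ | ⟨-, h4⟩⟩ := h <;> omega

theorem CodeRel.unique {τ : SchemeType} {k : ℕ} {y : (ℕ × ℕ) ⊕ (ℕ × ℕ × ℕ)} {p q q' : ℕ}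
    (h : CodeRel τ k y p q) (h' : CodeRel τ k y p q') : q = q' := by
  rcases y with ⟨g, d⟩ | ⟨ε, a, b⟩
  · exact h.1.trans h'.1.symm
  · obtain ⟨l, hl, -, -, -, -, -, hq⟩ := h
    obtain ⟨l', hl', -, -, -, -, -, hq'⟩ := h'
    obtain rfl : l = l' := by omega
    omega

/-- An `inl` code is bounded by the position through `g < d ≤ p`, an `inr` code by the root size
alone. So each function meets each level in a finite set. -/
theorem CodeRel.finite (τ : SchemeType) (k p : ℕ) : {y | ∃ q, CodeRel τ k y p q}.Finite := by
  have h1 : ((fun z : ℕ × ℕ => (Sum.inl z : (ℕ × ℕ) ⊕ (ℕ × ℕ × ℕ))) ''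
      (Set.Iic p ×ˢ Set.Iic p)).Finite :=
    ((Set.finite_Iic p).prod (Set.finite_Iic p)).image _
  have h2 : ((fun z : ℕ × ℕ × ℕ => (Sum.inr z : (ℕ × ℕ) ⊕ (ℕ × ℕ × ℕ))) ''
      (Set.Iio (2 ^ (τ.r k * τ.r k)) ×ˢ Set.Iio (τ.r k) ×ˢ Set.Iio (τ.r k))).Finite :=
    ((Set.finite_Iio _).prod ((Set.finite_Iio _).prod (Set.finite_Iio _))).image _
  refine (h1.union h2).subset ?_
  rintro (⟨g, d⟩ | ⟨ε, a, b⟩) ⟨q, h⟩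
  · obtain ⟨h1, h2, h3⟩ := h
    exact Or.inl ⟨(g, d), ⟨by simp; omega, by simpa using h3⟩, rfl⟩
  · obtain ⟨l, -, h1, h2, h3, -⟩ := h
    exact Or.inr ⟨(ε, a, b), ⟨h3, by simp; omega, h2⟩, rfl⟩

variable {Ω : Type*} [LinearOrder Ω] {τ : SchemeType} {𝓕 : Set (Finset Ω)}

/-- The set of points at which the function with index `α` takes the value `ξ`. -/
def schemeFiber (τ : SchemeType) (𝓕 : Set (Finset Ω)) (α ξ : Ω) : Set SchemePoint :=
  {x | Near 𝓕 x.1 ξ α ∧ CodeRel τ x.1 x.2 (schemePos 𝓕 x.1 α) (schemePos 𝓕 x.1 ξ)}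

namespace IsConstructionScheme

variable (h : IsConstructionScheme τ 𝓕)
include h

theorem schemeFiber_unique {α ξ ξ' : Ω} {x : SchemePoint} (hx : x ∈ schemeFiber τ 𝓕 α ξ)
    (hx' : x ∈ schemeFiber τ 𝓕 α ξ') : ξ = ξ' := by
  obtain ⟨F, hF, hξ, hα⟩ := hx.1
  obtain ⟨F', hF', hξ', hα'⟩ := hx'.1
  have hp := hx.2.unique hx'.2
  have hlt : schemePos 𝓕 x.1 ξ < schemePos 𝓕 x.1 α := hx.2.lt
  refine h.eq_of_schemePos_eq ⟨F, hF, hξ, h.mem_of_le hF' hF hα' hα hξ' ?_⟩ hp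
  by_contra hle
  have := h.schemePos_lt_schemePos hx'.1.symm (not_le.1 hle)
  omega

theorem lt_of_mem_schemeFiber {α ξ : Ω} {x : SchemePoint} (hx : x ∈ schemeFiber τ 𝓕 α ξ) :
    ξ < α := by
  have hlt := hx.2.lt
  by_contra hle
  rcases (not_lt.1 hle).eq_or_lt with rfl | hgt
  · exact lt_irrefl _ hlt
  · exact (h.schemePos_lt_schemePos hx.1.symm hgt).not_gt hlt

variable [Infinite Ω]

/-- Above level `k` the larger index lies past the same threshold `d` and, if `α` is outside the
root, in the same block. -/
theorem schemeFiber_mono {α β ξ : Ω} (hle : α ≤ β) {k : ℕ} (hn : Near 𝓕 k α β)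
    {x : SchemePoint} (hk : k < x.1) (hx : x ∈ schemeFiber τ 𝓕 α ξ) :
    x ∈ schemeFiber τ 𝓕 β ξ := by
  rcases hle.eq_or_lt with rfl | hlt
  · exact hx
  have hn' := h.near_mono hk.le hn
  have hpos := h.schemePos_lt_schemePos hn' hlt
  refine ⟨h.near_trans hx.1 hn' (h.lt_of_mem_schemeFiber hx).le, ?_⟩
  obtain ⟨l, y⟩ := x
  have hx2 := hx.2
  rcases y with ⟨g, d⟩ | ⟨ε, a, b⟩
  · exact ⟨hx2.1, hx2.2.1, hx2.2.2.trans hpos.le⟩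
  · obtain ⟨l', hl', h1, h2, h3, h4, h5, h6⟩ := hx2
    dsimp only at hl' hk hpos h5 h6 ⊢
    subst hl'
    rw [h.schemeBlock_eq_of_near hle (h.near_mono (Nat.lt_succ_iff.1 hk) hn) h5] at h6
    exact ⟨l', rfl, h1, h2, h3, h4, h5.trans hpos.le, h6⟩

theorem exists_finite_schemeFiber_subset {α β : Ω} (hle : α ≤ β) :
    ∃ E : Set SchemePoint, E.Finite ∧ ∀ ξ, schemeFiber τ 𝓕 α ξ ⊆ schemeFiber τ 𝓕 β ξ ∪ E := by
  obtain ⟨K, hK⟩ := h.exists_near {α, β}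
  have hn := hK K le_rfl α (by simp) β (by simp)
  refine ⟨⋃ k ∈ Set.Iic K, Prod.mk k '' {y | ∃ q, CodeRel τ k y (schemePos 𝓕 k α) q},
    (Set.finite_Iic K).biUnion fun k _ => (CodeRel.finite τ k _).image _, fun ξ x hx => ?_⟩
  by_cases hk : K < x.1
  · exact Or.inl (h.schemeFiber_mono hle hn hk hx)
  · refine Or.inr (Set.mem_biUnion (not_lt.1 hk : x.1 ∈ Set.Iic K) ?_)
    exact ⟨x.2, ⟨_, hx.2⟩, rfl⟩

/-- The `inl` code whose threshold is the position of `β` itself is seen by `β` but not by the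
smaller `α`; there is one at every large level. -/
theorem exists_infinite_subset_schemeFiber {α β ξ : Ω} (hξ : ξ < β) (hα : α < β) :
    ∃ I : Set SchemePoint, I.Infinite ∧ I ⊆ schemeFiber τ 𝓕 β ξ ∧
      ∀ η, Disjoint I (schemeFiber τ 𝓕 α η) := by
  obtain ⟨K, hK⟩ := h.exists_near {ξ, α, β}
  refine ⟨(fun k => (k, .inl (schemePos 𝓕 k ξ, schemePos 𝓕 k β))) '' Set.Ici K,
    (Set.Ici_infinite K).image fun a _ b _ hab => (Prod.mk.inj hab).1, ?_, fun η => ?_⟩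
  · rintro _ ⟨k, hk, rfl⟩
    have hn := hK k hk ξ (by simp) β (by simp)
    exact ⟨hn, rfl, h.schemePos_lt_schemePos hn hξ, le_rfl⟩
  · rw [Set.disjoint_left]
    rintro _ ⟨k, hk, rfl⟩ hx
    exact (h.schemePos_lt_schemePos (hK k hk α (by simp) β (by simp)) hα).not_ge hx.2.2.2

theorem schemeFiber_of_schemePos_eq {l : ℕ} {α α' ξ : Ω}
    (hn' : Near 𝓕 l ξ α') (hpos : schemePos 𝓕 l α = schemePos 𝓕 l α') {x : SchemePoint}
    (hl : x.1 ≤ l) (hx : x ∈ schemeFiber τ 𝓕 α ξ) : x ∈ schemeFiber τ 𝓕 α' ξ := by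
  refine ⟨h.near_of_schemePos_eq hl (h.lt_of_mem_schemeFiber hx).le hx.1 hn' rfl hpos, ?_⟩
  rw [← h.schemePos_eq_of_le hl hpos]
  exact hx.2

end IsConstructionScheme

end SchemeFibers

/-! ### Finding two compatible conditions by capturing. -/

section Compatibility

variable {Ω : Type*} [LinearOrder Ω]

/-- The position of `x` in the increasing enumeration of `c`. -/
def finsetIndex (c : Finset Ω) (x : Ω) : ℕ := (c.filter (· < x)).card

theorem finsetIndex_inj {c : Finset Ω} {x y : Ω} (hx : x ∈ c) (hy : y ∈ c)
    (hxy : finsetIndex c x = finsetIndex c y) : x = y := by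
  have key : ∀ {x y : Ω}, x ∈ c → x < y → finsetIndex c x < finsetIndex c y := by
    intro x y hx hlt
    refine Finset.card_lt_card ((Finset.ssubset_iff_of_subset ?_).2 ⟨x, by simp [hx, hlt], by simp⟩)
    intro z hz
    simp only [Finset.mem_filter] at hz ⊢
    exact ⟨hz.1, hz.2.trans hlt⟩
  rcases lt_trichotomy x y with hlt | hlt | hlt
  · exact absurd hxy (key hx hlt).ne
  · exact hlt
  · exact absurd hxy (key hy hlt).ne'

theorem finsetIndex_orderIso {A B P Q : Finset Ω} (φ : ↥A ≃o ↥B) (hP : P ⊆ A) (hQ : Q ⊆ B)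
    (hφ : ∀ x : ↥A, (φ x : Ω) ∈ Q ↔ (x : Ω) ∈ P) (x : ↥A) :
    finsetIndex Q (φ x) = finsetIndex P x := by
  symm
  refine Finset.card_bij (fun a ha => φ ⟨a, hP (Finset.mem_filter.1 ha).1⟩) ?_ ?_ ?_
  · intro a ha
    rw [Finset.mem_filter] at ha ⊢
    refine ⟨(hφ _).2 ha.1, ?_⟩
    exact φ.lt_iff_lt.2 (show (⟨a, hP ha.1⟩ : ↥A) < x from ha.2)
  · intro a ha b hb hab
    have := φ.injective (Subtype.ext hab)
    exact congrArg Subtype.val this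
  · intro b hb
    rw [Finset.mem_filter] at hb
    have hbB := hQ hb.1
    have h1 : φ (φ.symm ⟨b, hbB⟩) = ⟨b, hbB⟩ := φ.apply_symm_apply _
    refine ⟨φ.symm ⟨b, hbB⟩, Finset.mem_filter.2 ⟨(hφ _).1 (by rw [h1]; exact hb.1), ?_⟩, ?_⟩
    · have : φ.symm ⟨b, hbB⟩ < x := by
        rw [← φ.lt_iff_lt, h1]
        exact hb.2
      exact this
    · exact congrArg Subtype.val h1

variable {τ : SchemeType} {𝓕 : Set (Finset Ω)}

/-- The requirement that `χ_{e(ξ, μ)}` imposes on two indices `α` and `β`. -/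
def PairGood (τ : SchemeType) (𝓕 : Set (Finset Ω)) (e : Ω → Ω → Fin 2) (ξ μ α β : Ω) : Prop :=
  (e ξ μ = 0 → schemeFiber τ 𝓕 α ξ ∩ schemeFiber τ 𝓕 β μ = ∅) ∧
  (e ξ μ ≠ 0 → α ≠ β →
    ((schemeFiber τ 𝓕 α ξ ∩ schemeFiber τ 𝓕 β μ) ∪
      (schemeFiber τ 𝓕 β ξ ∩ schemeFiber τ 𝓕 α μ)).Nonempty)

namespace IsConstructionScheme

variable (h : IsConstructionScheme τ 𝓕)
include h

/-- Here `α'` is the copy of `α` in the block of `β`. The requirement on `α`, `β` is compared with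
that on `α'`, `β` up to level `l`, decided by the bit of `ε` at level `l + 1`, and vacuous above.
Indices in the root are their own copies. -/
theorem pairGood_cross [Infinite Ω] {l : ℕ} {F R : Finset Ω} {D : ℕ → Finset Ω}
    (hF : F ∈ schemeLevel 𝓕 (l + 1)) (hD : IsCanonicalDecomposition τ 𝓕 l F D R)
    {e : Ω → Ω → Fin 2} {ε : ℕ} (hε : ε < 2 ^ (τ.r (l + 1) * τ.r (l + 1)))
    (hbit : ∀ ξ ∈ R, ∀ μ ∈ R, ε.testBit (schemePos 𝓕 (l + 1) ξ * τ.r (l + 1) +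
      schemePos 𝓕 (l + 1) μ) = true ↔ e ξ μ ≠ 0)
    {i j : ℕ} (hi : i < τ.n (l + 1)) (hj : j < τ.n (l + 1))
    (hij : (i = 2 * ε ∧ j = 2 * ε + 1) ∨ (j = 2 * ε ∧ i = 2 * ε + 1))
    {ξ μ α β α' : Ω} (hξ : ξ ∈ R) (hμ : μ ∈ R) (hξμ : ξ < μ) (hα : α ∈ D i) (hβ : β ∈ D j)
    (hα' : α' ∈ D j) (hpos : schemePos 𝓕 l α = schemePos 𝓕 l α')
    (hβR : β ∈ R → PairGood τ 𝓕 e ξ μ α β) (hgood : PairGood τ 𝓕 e ξ μ α' β) :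
    PairGood τ 𝓕 e ξ μ α β := by
  by_cases hβR' : β ∈ R
  · exact hβR hβR'
  have hRi := hD.root_subset hi
  have hRj := hD.root_subset hj
  by_cases hαR : α ∈ R
  · rwa [h.eq_of_schemePos_eq ⟨D j, hD.1.1 j hj, hRj hαR, hα'⟩ hpos]
  have hFi := hD.subset hi
  have hFj := hD.subset hj
  obtain ⟨hbα, hrα⟩ := h.schemeBlock_eq hF hD hi hα hαR
  obtain ⟨hbβ, hrβ⟩ := h.schemeBlock_eq hF hD hj hβ hβR'
  have hpξμ := h.schemePos_lt_schemePos ⟨F, hF, hFi (hRi hξ), hFi (hRi hμ)⟩ hξμ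
  have hpμ := (h.mem_root_iff hF hD (hFi (hRi hμ))).1 hμ
  refine ⟨fun he => ?_, fun he _ => ?_⟩
  · rw [Set.eq_empty_iff_forall_notMem]
    rintro ⟨k, y⟩ ⟨hx1, hx2⟩
    rcases lt_trichotomy k (l + 1) with hk | rfl | hk
    · have hx3 := h.schemeFiber_of_schemePos_eq (α := α) (α' := α') (l := l)
        ⟨D j, hD.1.1 j hj, hRj hξ, hα'⟩ hpos (Nat.lt_succ_iff.1 hk) hx1
      exact Set.eq_empty_iff_forall_notMem.1 (hgood.1 he) _ ⟨hx3, hx2⟩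
    · rcases y with ⟨g, d⟩ | ⟨ε', a, b⟩
      -- An `inl` code is constant, so it cannot give both `ξ` and `μ`.
      · have := hx1.2.1
        have := hx2.2.1
        dsimp only at *
        omega
      · obtain ⟨l1, hl1, h1, h2, h3, h4, h5, h6⟩ := hx1.2
        obtain ⟨l2, hl2, -, -, -, -, -, h7⟩ := hx2.2
        dsimp only at *
        obtain rfl : l1 = l := by omega
        obtain rfl : l2 = l1 := by omega
        rw [hbα] at h6
        rw [hbβ] at h7
        -- The two blocks form the pair of `ε`, so no other code reaches them. Then `a < b` and the
        -- order of the positions of `ξ` and `μ` identify `a` and `b`.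
        obtain rfl : ε' = ε := by omega
        obtain rfl : a = schemePos 𝓕 (l2 + 1) ξ := by omega
        obtain rfl : b = schemePos 𝓕 (l2 + 1) μ := by omega
        exact (hbit ξ hξ μ hμ).1 h4 he
    -- Both indices lie in `F`, so the larger one would take both values at this point.
    · have hne : ξ ≠ μ := hξμ.ne
      rcases le_total α β with hle | hle
      · exact hne (h.schemeFiber_unique
          (h.schemeFiber_mono hle ⟨F, hF, hFi hα, hFj hβ⟩ hk hx1) hx2)
      · exact hne (h.schemeFiber_unique hx1
          (h.schemeFiber_mono hle ⟨F, hF, hFj hβ, hFi hα⟩ hk hx2))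
  · have hb := (hbit ξ hξ μ hμ).2 he
    have hmem : ∀ {η γ : Ω} {t : ℕ}, t < τ.n (l + 1) → η ∈ R → γ ∈ D t →
        τ.r (l + 1) ≤ schemePos 𝓕 (l + 1) γ →
        ((schemeBlock τ l (schemePos 𝓕 (l + 1) γ) = 2 * ε ∧ η = ξ) ∨
          (schemeBlock τ l (schemePos 𝓕 (l + 1) γ) = 2 * ε + 1 ∧ η = μ)) →
        ((l + 1, .inr (ε, schemePos 𝓕 (l + 1) ξ, schemePos 𝓕 (l + 1) μ)) : SchemePoint) ∈
          schemeFiber τ 𝓕 γ η := by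
      intro η γ t ht hη hγ hr hblock
      refine ⟨⟨F, hF, hD.subset ht (hD.root_subset ht hη), hD.subset ht hγ⟩, l, rfl, hpξμ, hpμ,
        hε, hb, hr, ?_⟩
      rcases hblock with ⟨h1, rfl⟩ | ⟨h1, rfl⟩
      · exact Or.inl ⟨h1, rfl⟩
      · exact Or.inr ⟨h1, rfl⟩
    refine ⟨(l + 1, .inr (ε, schemePos 𝓕 (l + 1) ξ, schemePos 𝓕 (l + 1) μ)), ?_⟩
    rcases hij with ⟨rfl, rfl⟩ | ⟨rfl, rfl⟩
    · exact Or.inl ⟨hmem hi hξ hα hrα (Or.inl ⟨hbα, rfl⟩), hmem hj hμ hβ hrβ (Or.inr ⟨hbβ, rfl⟩)⟩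
    · exact Or.inr ⟨hmem hj hξ hβ hrβ (Or.inl ⟨hbβ, rfl⟩), hmem hi hμ hα hrα (Or.inr ⟨hbα, rfl⟩)⟩

/-- The restriction of `e` to the root, written as an `r × r` bit matrix, selects the pair of blocks
to use. -/
theorem exists_testBit_iff {l : ℕ} {F R : Finset Ω} {D : ℕ → Finset Ω}
    (hF : F ∈ schemeLevel 𝓕 (l + 1)) (hD : IsCanonicalDecomposition τ 𝓕 l F D R)
    (e : Ω → Ω → Fin 2) :
    ∃ ε < 2 ^ (τ.r (l + 1) * τ.r (l + 1)), ∀ ξ ∈ R, ∀ μ ∈ R,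
      ε.testBit (schemePos 𝓕 (l + 1) ξ * τ.r (l + 1) + schemePos 𝓕 (l + 1) μ) = true ↔
        e ξ μ ≠ 0 := by
  classical
  have h0 : 0 < τ.n (l + 1) := by have := τ.two_le_n (l + 1) (by omega); omega
  have hRF : ∀ ξ ∈ R, ξ ∈ F := fun ξ hξ => hD.subset h0 (hD.root_subset h0 hξ)
  set r := τ.r (l + 1)
  let f : Fin (r * r) → Bool := fun i => decide (∃ ξ ∈ R, ∃ μ ∈ R,
    schemePos 𝓕 (l + 1) ξ = i / r ∧ schemePos 𝓕 (l + 1) μ = i % r ∧ e ξ μ ≠ 0)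
  refine ⟨Nat.ofBits f, Nat.ofBits_lt_two_pow f, fun ξ hξ μ hμ => ?_⟩
  have hpξ : schemePos 𝓕 (l + 1) ξ < r := (h.mem_root_iff hF hD (hRF ξ hξ)).1 hξ
  have hpμ : schemePos 𝓕 (l + 1) μ < r := (h.mem_root_iff hF hD (hRF μ hμ)).1 hμ
  have hlt : schemePos 𝓕 (l + 1) ξ * r + schemePos 𝓕 (l + 1) μ < r * r := by
    have := Nat.mul_le_mul_right r (Nat.succ_le_of_lt hpξ)
    rw [Nat.succ_mul] at this
    omega
  rw [Nat.testBit_ofBits_lt f _ hlt, decide_eq_true_iff]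
  have hdiv : (schemePos 𝓕 (l + 1) ξ * r + schemePos 𝓕 (l + 1) μ) / r =
      schemePos 𝓕 (l + 1) ξ := by
    rw [Nat.mul_comm, Nat.mul_add_div (by omega), Nat.div_eq_of_lt hpμ, add_zero]
  have hmod : (schemePos 𝓕 (l + 1) ξ * r + schemePos 𝓕 (l + 1) μ) % r =
      schemePos 𝓕 (l + 1) μ := by
    rw [Nat.mul_comm, Nat.mul_add_mod, Nat.mod_eq_of_lt hpμ]
  simp only [hdiv, hmod]
  constructor
  · rintro ⟨ξ', hξ', μ', hμ', h1, h2, h3⟩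
    rwa [h.eq_of_schemePos_eq ⟨F, hF, hRF ξ' hξ', hRF ξ hξ⟩ h1,
      h.eq_of_schemePos_eq ⟨F, hF, hRF μ' hμ', hRF μ hμ⟩ h2] at h3
  · exact fun he => ⟨ξ, hξ, μ, hμ, rfl, rfl, he⟩

/-- Captured sets are transported by increasing bijections from one block, which preserve both the
index in the set and the position in the block. -/
theorem schemePos_eq_of_finsetIndex_eq {l : ℕ} {A : Finset Ω} (hA : A ∈ schemeLevel 𝓕 l)
    {D c : ℕ → Finset Ω} {n : ℕ} (hDl : ∀ i < n, D i ∈ schemeLevel 𝓕 l) {c₀ : Finset Ω}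
    (hc₀ : c₀ ⊆ A) (hc : ∀ i < n, c i ⊆ D i ∧
      ∃ φ : ↥A ≃o ↥(D i), ∀ x : ↥A, (φ x : Ω) ∈ c i ↔ (x : Ω) ∈ c₀)
    {i j : ℕ} (hi : i < n) (hj : j < n) {x y : Ω} (hx : x ∈ c i) (hy : y ∈ c j)
    (hxy : finsetIndex (c i) x = finsetIndex (c j) y) :
    schemePos 𝓕 l x = schemePos 𝓕 l y := by
  have key : ∀ {i : ℕ} {x : Ω}, i < n → x ∈ c i → ∃ z ∈ c₀,
      finsetIndex (c i) x = finsetIndex c₀ z ∧ schemePos 𝓕 l x = schemePos 𝓕 l z := by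
    intro i x hi hx
    obtain ⟨hcD, φ, hφ⟩ := hc i hi
    have hxD := hcD hx
    obtain ⟨z, hz⟩ := φ.surjective ⟨x, hxD⟩
    have hzx : (φ z : Ω) = x := congrArg Subtype.val hz
    refine ⟨z, (hφ z).1 (by rw [hzx]; exact hx), ?_, ?_⟩
    · rw [← hzx]
      exact finsetIndex_orderIso φ hc₀ hcD hφ z
    · rw [h.schemePos_eq (hDl i hi) hxD, h.schemePos_eq hA z.2, ← hzx]
      exact finsetIndex_orderIso φ subset_rfl subset_rfl (fun x => by simp) z
  obtain ⟨z, hz, h1, h2⟩ := key hi hx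
  obtain ⟨w, hw, h3, h4⟩ := key hj hy
  rw [h2, h4, finsetIndex_inj hz hw (by rw [← h1, ← h3, hxy])]

end IsConstructionScheme

/-- The coordinates that occur in a set of triples. -/
def tripleSupport (A : Finset (Ω × Ω × Ω)) : Finset Ω :=
  A.biUnion fun t => {t.1, t.2.1, t.2.2}

theorem mem_tripleSupport {A : Finset (Ω × Ω × Ω)} {ξ μ α : Ω} (ht : (ξ, μ, α) ∈ A) :
    ξ ∈ tripleSupport A ∧ μ ∈ tripleSupport A ∧ α ∈ tripleSupport A := by
  simp only [tripleSupport, Finset.mem_biUnion]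
  exact ⟨⟨_, ht, by simp⟩, ⟨_, ht, by simp⟩, ⟨_, ht, by simp⟩⟩

/-- The isomorphism type of a set of triples over its support. -/
def tripleType (A : Finset (Ω × Ω × Ω)) : Finset (ℕ × ℕ × ℕ) :=
  A.image fun t => (finsetIndex (tripleSupport A) t.1, finsetIndex (tripleSupport A) t.2.1,
    finsetIndex (tripleSupport A) t.2.2)

theorem exists_of_tripleType_eq {A B : Finset (Ω × Ω × Ω)} (hAB : tripleType A = tripleType B)
    {ξ μ α : Ω} (ht : (ξ, μ, α) ∈ A) : ∃ ξ' μ' α', (ξ', μ', α') ∈ B ∧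
      finsetIndex (tripleSupport A) ξ = finsetIndex (tripleSupport B) ξ' ∧
      finsetIndex (tripleSupport A) μ = finsetIndex (tripleSupport B) μ' ∧
      finsetIndex (tripleSupport A) α = finsetIndex (tripleSupport B) α' := by
  have h1 : (finsetIndex (tripleSupport A) ξ, finsetIndex (tripleSupport A) μ,
      finsetIndex (tripleSupport A) α) ∈ tripleType A := Finset.mem_image.2 ⟨_, ht, rfl⟩
  rw [hAB] at h1
  obtain ⟨⟨ξ', μ', α'⟩, h2, h3⟩ := Finset.mem_image.1 h1
  simp only [Prod.mk.injEq] at h3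
  exact ⟨ξ', μ', α', h2, h3.1.symm, h3.2.1.symm, h3.2.2.symm⟩

theorem eq_of_tripleType_eq {A B : Finset (Ω × Ω × Ω)} (hAB : tripleType A = tripleType B)
    (hs : tripleSupport A = tripleSupport B) : A = B := by
  have key : ∀ {A B : Finset (Ω × Ω × Ω)}, tripleType A = tripleType B →
      tripleSupport A = tripleSupport B → A ⊆ B := by
    rintro A B hAB hs ⟨ξ, μ, α⟩ ht
    obtain ⟨ξ', μ', α', ht', h1, h2, h3⟩ := exists_of_tripleType_eq hAB ht
    obtain ⟨m1, m2, m3⟩ := mem_tripleSupport ht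
    obtain ⟨m1', m2', m3'⟩ := mem_tripleSupport ht'
    rw [hs] at m1 m2 m3 h1 h2 h3
    rwa [finsetIndex_inj m1 m1' h1, finsetIndex_inj m2 m2' h2, finsetIndex_inj m3 m3' h3]
  exact (key hAB hs).antisymm (key hAB.symm hs.symm)

theorem exists_uncountable_fiber {P Q : Type*} [Countable Q] (hP : ¬ Countable P) (g : P → Q) :
    ∃ t, ¬ {p | g p = t}.Countable := by
  by_contra! hcon
  apply hP
  have hU : (⋃ t, {p | g p = t}) = Set.univ := Set.eq_univ_of_forall fun p => Set.mem_iUnion.2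
    ⟨g p, rfl⟩
  exact Set.countable_univ_iff.1 (hU ▸ Set.countable_iUnion hcon)

/-- Among uncountably many conditions, two are compatible. -/
theorem IsFullyCapturing.exists_pairGood [Infinite Ω]
    (hc : IsFullyCapturing pairingType 𝓕) (h : IsConstructionScheme pairingType 𝓕)
    (e : Ω → Ω → Fin 2) {P : Type*} (hP : ¬ Countable P) (A : P → Finset (Ω × Ω × Ω))
    (hlt : ∀ p, ∀ ξ μ α, (ξ, μ, α) ∈ A p → ξ < μ)
    (hgood : ∀ p, ∀ ξ μ α β, (ξ, μ, α) ∈ A p → (ξ, μ, β) ∈ A p →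
      PairGood pairingType 𝓕 e ξ μ α β) :
    ∃ p q, p ≠ q ∧ ∀ ξ μ α β, (ξ, μ, α) ∈ A p ∪ A q → (ξ, μ, β) ∈ A p ∪ A q →
      PairGood pairingType 𝓕 e ξ μ α β := by
  by_cases hinj : Function.Injective A
  swap
  · obtain ⟨p, q, hpq, hne⟩ := Function.not_injective_iff.1 hinj
    refine ⟨p, q, hne, ?_⟩
    rw [hpq, Finset.union_self]
    exact hgood q
  obtain ⟨t, ht⟩ := exists_uncountable_fiber hP (fun p => tripleType (A p))
  have hS : ¬ ((fun p => tripleSupport (A p)) '' {p | tripleType (A p) = t}).Countable := by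
    intro hcount
    refine ht (Set.countable_of_injective_of_countable_image ?_ hcount)
    intro p hp q hq hpq
    -- With the isomorphism type fixed, the support recovers the condition, so uncountably many
    -- supports remain.
    exact hinj (eq_of_tripleType_eq (hp.trans hq.symm) hpq)
  obtain ⟨C, l, hCS, -, F, hF, D, R, c, hD, rfl, hcap⟩ := hc _ hS 0
  obtain ⟨ε, hε, hbit⟩ := h.exists_testBit_iff hF hD e
  have hn : pairingType.n (l + 1) =
    2 * 2 ^ (pairingType.r (l + 1) * pairingType.r (l + 1)) := pairingType_n (l + 1)
  have hi : 2 * ε < pairingType.n (l + 1) := by omega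
  have hj : 2 * ε + 1 < pairingType.n (l + 1) := by omega
  have h0 : 0 < pairingType.n (l + 1) := by omega
  have hex : ∀ i < pairingType.n (l + 1), ∃ p, tripleType (A p) = t ∧ tripleSupport (A p) = c i := by
    intro i hi
    exact hCS (Finset.mem_coe.2 (Finset.mem_image_of_mem c (Finset.mem_range.2 hi)))
  obtain ⟨p, hpt, hpc⟩ := hex _ hi
  obtain ⟨q, hqt, hqc⟩ := hex _ hj
  have hcross : ∀ {i j : ℕ} (_ : i < pairingType.n (l + 1)) (_ : j < pairingType.n (l + 1))
      (_ : (i = 2 * ε ∧ j = 2 * ε + 1) ∨ (j = 2 * ε ∧ i = 2 * ε + 1)) {p q : P}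
      (_ : tripleType (A p) = t) (_ : tripleType (A q) = t) (_ : tripleSupport (A p) = c i)
      (_ : tripleSupport (A q) = c j) {ξ μ α β : Ω}, (ξ, μ, α) ∈ A p → (ξ, μ, β) ∈ A q →
      (∃ α', (ξ, μ, α') ∈ A q ∧ schemePos 𝓕 l α = schemePos 𝓕 l α') ∧
        (ξ ∈ R ∧ μ ∈ R) ∧ α ∈ D i ∧ β ∈ D j := by
    intro i j hi hj hij p q hpt hqt hpc hqc ξ μ α β hα hβ
    obtain ⟨ξ', μ', α', hA, h1, h2, h3⟩ := exists_of_tripleType_eq (hpt.trans hqt.symm) hα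
    rw [hpc, hqc] at h1 h2 h3
    have hne : i ≠ j := by omega
    have m1 := mem_tripleSupport hα
    have m2 := mem_tripleSupport hβ
    have m3 := mem_tripleSupport hA
    rw [hpc] at m1
    rw [hqc] at m2 m3
    have hpos : ∀ {x y : Ω}, x ∈ c i → y ∈ c j → finsetIndex (c i) x = finsetIndex (c j) y →
        schemePos 𝓕 l x = schemePos 𝓕 l y := fun hx hy hxy =>
      h.schemePos_eq_of_finsetIndex_eq (hD.1.1 0 h0) hD.1.1 (hcap 0 h0).1
        (fun i hi => ⟨(hcap i hi).1, (hcap i hi).2.2⟩) hi hj hx hy hxy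
    have near : ∀ {x y : Ω}, x ∈ c j → y ∈ c j → Near 𝓕 l x y := fun hx hy =>
      ⟨D j, hD.1.1 j hj, (hcap j hj).1 hx, (hcap j hj).1 hy⟩
    -- The copy of `ξ` in `D j` has the position of `ξ`, which already lies in `D j`; hence `ξ` is
    -- its own copy, and likewise `μ`.
    have e1 := h.eq_of_schemePos_eq (near m2.1 m3.1) (hpos m1.1 m3.1 h1)
    have e2 := h.eq_of_schemePos_eq (near m2.2.1 m3.2.1) (hpos m1.2.1 m3.2.1 h2)
    subst e1 e2
    refine ⟨⟨α', hA, hpos m1.2.2 m3.2.2 h3⟩, ?_, (hcap i hi).1 m1.2.2, (hcap j hj).1 m2.2.2⟩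
    rw [← hD.2.1 i hi j hj hne]
    exact ⟨Finset.mem_inter.2 ⟨(hcap i hi).1 m1.1, (hcap j hj).1 m2.1⟩,
      Finset.mem_inter.2 ⟨(hcap i hi).1 m1.2.1, (hcap j hj).1 m2.2.1⟩⟩
  have hmain : ∀ {i j : ℕ} (_ : i < pairingType.n (l + 1)) (_ : j < pairingType.n (l + 1))
      (_ : (i = 2 * ε ∧ j = 2 * ε + 1) ∨ (j = 2 * ε ∧ i = 2 * ε + 1)) {p q : P}
      (_ : tripleType (A p) = t) (_ : tripleType (A q) = t) (_ : tripleSupport (A p) = c i)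
      (_ : tripleSupport (A q) = c j) {ξ μ α β : Ω}, (ξ, μ, α) ∈ A p → (ξ, μ, β) ∈ A q →
      PairGood pairingType 𝓕 e ξ μ α β := by
    intro i j hi hj hij p q hpt hqt hpc hqc ξ μ α β hα hβ
    obtain ⟨⟨α', hA, hpos⟩, ⟨hξ, hμ⟩, hαD, hβD⟩ := hcross hi hj hij hpt hqt hpc hqc hα hβ
    have hα'D : α' ∈ D j := (hcap j hj).1 (hqc ▸ (mem_tripleSupport hA).2.2)
    refine h.pairGood_cross hF hD hε hbit hi hj hij hξ hμ (hlt p ξ μ α hα) hαD hβD hα'D hpos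
      (fun hβR => ?_) (hgood q ξ μ α' β hA hβ)
    -- If `β` is in the root, its copy on the side of `p` is `β` itself, so the requirement already
    -- holds within `p`.
    obtain ⟨⟨β', hB, hpos'⟩, -⟩ := hcross hj hi hij.symm hqt hpt hqc hpc hβ hα
    have hβ'D : β' ∈ D i := (hcap i hi).1 (hpc ▸ (mem_tripleSupport hB).2.2)
    have heq := h.eq_of_schemePos_eq ⟨D i, hD.1.1 i hi, hD.root_subset hi hβR, hβ'D⟩ hpos'
    subst heq
    exact hgood p ξ μ α β hα hB
  refine ⟨p, q, ?_, fun ξ μ α β hα hβ => ?_⟩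
  -- A common support would be contained in `R`, but captured sets leave the root.
  · rintro rfl
    obtain ⟨x, hx⟩ := (hcap _ hi).2.1
    rw [Finset.mem_sdiff] at hx
    have h1 : x ∈ D (2 * ε + 1) := (hcap _ hj).1 (hqc ▸ hpc ▸ hx.1)
    apply hx.2
    rw [← hD.2.1 _ hi _ hj (by omega)]
    exact Finset.mem_inter.2 ⟨(hcap _ hi).1 hx.1, h1⟩
  · rcases Finset.mem_union.1 hα with hα | hα <;> rcases Finset.mem_union.1 hβ with hβ | hβ
    · exact hgood p ξ μ α β hα hβ
    · exact hmain hi hj (Or.inl ⟨rfl, rfl⟩) hpt hqt hpc hqc hα hβ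
    · exact hmain hj hi (Or.inr ⟨rfl, rfl⟩) hqt hpt hqc hpc hα hβ
    · exact hgood q ξ μ α β hα hβ

end Compatibility

/-! ### Order types of the index sets. -/

section IndexSets

/-- The inclusion of `ω₁ \ ω` into `ω₁`. -/
def Omega1Tail.incl (α : Omega1Tail) : Omega1 := ⟨α.1, α.2.2⟩

theorem Omega1Tail.incl_injective : Function.Injective Omega1Tail.incl := fun _ _ h =>
  Subtype.ext (congrArg (fun a : Omega1 => a.1) h)

/-- Subtracting `a` maps the interval from `a` to `ω₁` onto `ω₁`, because `ω₁` is closed under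
addition. -/
theorem exists_orderIso_Iio_omega_one {ι : Type*} [LinearOrder ι] (v : ι → Ordinal.{0})
    (hv : ∀ i j, v i < v j ↔ i < j) {a : Ordinal.{0}} (ha : a < ω₁)
    (hrange : ∀ x, (∃ i, v i = x) ↔ a ≤ x ∧ x < ω₁) : Nonempty (ι ≃o Set.Iio (ω₁ : Ordinal.{0})) := by
  have hmono : StrictMono v := fun i j hij => (hv i j).2 hij
  let g : ι → Set.Iio (ω₁ : Ordinal.{0}) := fun i =>
    ⟨v i - a, (Ordinal.sub_le_self _ _).trans_lt ((hrange (v i)).1 ⟨i, rfl⟩).2⟩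
  have hle : ∀ i, a ≤ v i := fun i => ((hrange (v i)).1 ⟨i, rfl⟩).1
  have hg : StrictMono g := by
    intro i j hij
    show v i - a < v j - a
    rw [← add_lt_add_iff_left a, Ordinal.add_sub_cancel_of_le (hle i),
      Ordinal.add_sub_cancel_of_le (hle j)]
    exact hmono hij
  refine ⟨hg.orderIsoOfSurjective g ?_⟩
  rintro ⟨x, hx⟩
  obtain ⟨i, hi⟩ := (hrange (a + x)).2 ⟨le_self_add, Ordinal.isPrincipal_add_omega 1 ha hx⟩
  exact ⟨i, Subtype.ext (by simp [g, hi])⟩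

theorem nonempty_orderIso_Omega1Tail : Nonempty (Omega1Tail ≃o Set.Iio (ω₁ : Ordinal.{0})) :=
  exists_orderIso_Iio_omega_one (fun i => i.1) (fun _ _ => Iff.rfl) Ordinal.omega0_lt_omega_one
    fun x => ⟨by rintro ⟨i, rfl⟩; exact i.2, fun hx => ⟨⟨x, hx⟩, rfl⟩⟩

theorem nonempty_orderIso_Ioi (μ : Omega1Tail) :
    Nonempty (Set.Ioi μ ≃o Set.Iio (ω₁ : Ordinal.{0})) := by
  refine exists_orderIso_Iio_omega_one (fun i => i.1.1) (fun _ _ => Iff.rfl) (a := Order.succ μ.1)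
    ((Cardinal.isSuccLimit_omega 1).succ_lt μ.2.2) fun x => ?_
  constructor
  · rintro ⟨i, rfl⟩
    exact ⟨Order.succ_le_of_lt i.2, i.1.2.2⟩
  · rintro ⟨h1, h2⟩
    have hμ : μ.1 < x := Order.succ_le_iff.1 h1
    exact ⟨⟨⟨x, μ.2.1.trans hμ.le, h2⟩, hμ⟩, rfl⟩

theorem not_countable_Iio_omega_one : ¬ Countable (Set.Iio (ω₁ : Ordinal.{0})) := by
  rw [← Cardinal.mk_le_aleph0_iff, Cardinal.mk_Iio_ordinal, not_le]
  simp

instance : Infinite Omega1 := by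
  by_contra hfin
  rw [not_infinite_iff_finite] at hfin
  exact not_countable_Iio_omega_one Finite.to_countable

theorem not_countable_Ioi (μ : Omega1Tail) : ¬ Countable (Set.Ioi μ) := fun hc =>
  not_countable_Iio_omega_one ((nonempty_orderIso_Ioi μ).some.toEquiv.countable_iff.1 hc)

end IndexSets

/-! ### The coherent family on `X`, its gaps and the chain conditions. -/

section Family

universe u

variable {X : Type u}

/-- The domain of the function with index `α` and fibers `V α ξ`. -/
def towerSet (V : Omega1 → Omega1 → Set X) (α : Omega1Tail) : Set X :=
  {x | ∃ ξ, x ∈ V α.incl ξ}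

/-- The function with index `α` and fibers `V α ξ`, `ξ < α`. -/
noncomputable def towerFun (V : Omega1 → Omega1 → Set X) (hlt : ∀ α ξ x, x ∈ V α ξ → ξ < α)
    (α : Omega1Tail) : towerSet V α → Set.Iio (α : Ordinal.{0}) := fun x =>
  ⟨(Classical.choose x.2).1, hlt _ _ _ (Classical.choose_spec x.2)⟩

theorem towerFun_eq_iff {V : Omega1 → Omega1 → Set X} (hlt : ∀ α ξ x, x ∈ V α ξ → ξ < α)
    (huniq : ∀ α ξ ξ' x, x ∈ V α ξ → x ∈ V α ξ' → ξ = ξ') {α : Omega1Tail} {x : X}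
    (hx : x ∈ towerSet V α) (ξ : Omega1) :
    (towerFun V hlt α ⟨x, hx⟩ : Ordinal.{0}) = ξ.1 ↔ x ∈ V α.incl ξ := by
  have hs := Classical.choose_spec hx
  constructor
  · intro h
    have : Classical.choose hx = ξ := Subtype.ext h
    rwa [← this]
  · intro h
    exact congrArg Subtype.val (huniq _ _ _ _ hs h)

theorem fiber_towerFun {V : Omega1 → Omega1 → Set X} (hlt : ∀ α ξ x, x ∈ V α ξ → ξ < α)
    (huniq : ∀ α ξ ξ' x, x ∈ V α ξ → x ∈ V α ξ' → ξ = ξ') (ξ α : Omega1Tail) :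
    fiber (towerFun V hlt) ξ α = V α.incl ξ.incl := by
  ext x
  constructor
  · rintro ⟨hx, h⟩
    exact (towerFun_eq_iff hlt huniq hx ξ.incl).1 h
  · intro h
    exact ⟨⟨_, h⟩, (towerFun_eq_iff hlt huniq ⟨_, h⟩ ξ.incl).2 h⟩

theorem almostSSubset_of_infinite {A B I : Set X} (h : (A \ B).Finite) (hI : I.Infinite)
    (hIB : I ⊆ B) (hIA : Disjoint I A) : AlmostSSubset A B :=
  ⟨h, fun hc => hI (hc.2.subset fun _ hx => ⟨hIB hx, Set.disjoint_left.1 hIA hx⟩)⟩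

theorem mem_chiZero_iff {ι : Type*} {A B : ι → Set X} {σ : Finset ι} :
    σ ∈ chiZero A B ↔ ∀ a ∈ σ, ∀ b ∈ σ, A a ∩ B b = ∅ := by
  simp only [chiZero, Set.mem_ofPred_eq, Set.eq_empty_iff_forall_notMem, Set.mem_inter_iff,
    Set.mem_iUnion, not_and]
  constructor
  · intro h a ha b hb x hxa hxb
    exact h x ⟨a, ha, hxa⟩ ⟨b, hb, hxb⟩
  · rintro h x ⟨a, ha, hxa⟩ ⟨b, hb, hxb⟩
    exact h a ha b hb x hxa hxb

/-- The family of fibers on `X` obtained from a construction scheme. -/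
def pulledFiber (𝓕 : Set (Finset Omega1)) (φ : X ≃ SchemePoint) (α ξ : Omega1) : Set X :=
  φ ⁻¹' schemeFiber pairingType 𝓕 α ξ

theorem mem_chi_iff {ι : Type*} {𝓕 : Set (Finset Omega1)} {φ : X ≃ SchemePoint}
    {A B : ι → Set X} {v : ι → Omega1} (hv : Function.Injective v) {ξ μ : Omega1}
    (hA : ∀ i, A i = pulledFiber 𝓕 φ (v i) ξ) (hB : ∀ i, B i = pulledFiber 𝓕 φ (v i) μ)
    {e : Omega1 → Omega1 → Fin 2} {σ : Finset ι} :
    σ ∈ (if e ξ μ = 0 then chiZero A B else chiOne A B) ↔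
      ∀ a ∈ σ, ∀ b ∈ σ, PairGood pairingType 𝓕 e ξ μ (v a) (v b) := by
  have key0 : ∀ a b, A a ∩ B b = ∅ ↔ schemeFiber pairingType 𝓕 (v a) ξ ∩
      schemeFiber pairingType 𝓕 (v b) μ = ∅ := by
    intro a b
    rw [hA, hB, pulledFiber, pulledFiber, ← Set.preimage_inter,
      Set.preimage_eq_empty_iff, φ.surjective.range_eq, Set.disjoint_univ]
  have key1 : ∀ a b, ((A a ∩ B b) ∪ (A b ∩ B a)).Nonempty ↔
      ((schemeFiber pairingType 𝓕 (v a) ξ ∩ schemeFiber pairingType 𝓕 (v b) μ) ∪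
        (schemeFiber pairingType 𝓕 (v b) ξ ∩ schemeFiber pairingType 𝓕 (v a) μ)).Nonempty := by
    intro a b
    rw [hA, hB, hA, hB, ← φ.surjective.nonempty_preimage (s := _ ∪ _)]
    rfl
  by_cases he : e ξ μ = 0
  · simp only [he, if_true, mem_chiZero_iff, PairGood, key0, ne_eq, not_true_eq_false,
      false_implies, and_true, true_implies]
  · simp only [he, if_false, chiOne, Set.mem_ofPred_eq, PairGood, key1, ne_eq, not_false_eq_true,
      false_implies, true_and, true_implies, hv.eq_iff]

variable {𝓕 : Set (Finset Omega1)} (hs : IsConstructionScheme pairingType 𝓕)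
  (hc : IsFullyCapturing pairingType 𝓕) (φ : X ≃ SchemePoint)
include hs

theorem pulledFiber_lt (α ξ : Omega1) (x : X) (hx : x ∈ pulledFiber 𝓕 φ α ξ) : ξ < α :=
  hs.lt_of_mem_schemeFiber hx

theorem pulledFiber_unique (α ξ ξ' : Omega1) (x : X) (hx : x ∈ pulledFiber 𝓕 φ α ξ)
    (hx' : x ∈ pulledFiber 𝓕 φ α ξ') : ξ = ξ' :=
  hs.schemeFiber_unique hx hx'

theorem exists_finite_pulledFiber_subset {α β : Omega1} (hle : α ≤ β) :
    ∃ E : Set X, E.Finite ∧ ∀ ξ, pulledFiber 𝓕 φ α ξ ⊆ pulledFiber 𝓕 φ β ξ ∪ E := by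
  obtain ⟨E, hE, h⟩ := hs.exists_finite_schemeFiber_subset hle
  exact ⟨φ ⁻¹' E, hE.preimage φ.injective.injOn, fun ξ x hx => h ξ hx⟩

theorem exists_infinite_subset_pulledFiber {α β ξ : Omega1} (hξ : ξ < β) (hα : α < β) :
    ∃ I : Set X, I.Infinite ∧ I ⊆ pulledFiber 𝓕 φ β ξ ∧
      ∀ η, Disjoint I (pulledFiber 𝓕 φ α η) := by
  obtain ⟨I, hI, h1, h2⟩ := hs.exists_infinite_subset_schemeFiber hξ hα
  exact ⟨φ ⁻¹' I, hI.preimage (by simp [φ.surjective.range_eq]), Set.preimage_mono h1,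
    fun η => (h2 η).preimage φ⟩

theorem isPretower_pulledFiber (ξ μ : Omega1Tail) (hξμ : ξ ≤ μ) :
    IsPretower ω₁ (fun α : Set.Ioi μ => pulledFiber 𝓕 φ α.1.incl ξ.incl) where
  orderType := nonempty_orderIso_Ioi μ
  infinite α := by
    have hlt : ξ.incl < α.1.incl := hξμ.trans_lt (Set.mem_Ioi.1 α.2)
    obtain ⟨I, hI, h1, -⟩ := exists_infinite_subset_pulledFiber hs φ hlt hlt
    exact hI.mono h1
  increasing α β hαβ := by
    have hξ : ξ.incl < β.1.incl := hξμ.trans_lt (Set.mem_Ioi.1 β.2)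
    have hlt : α.1.incl < β.1.incl := hαβ
    obtain ⟨E, hE, h⟩ := exists_finite_pulledFiber_subset hs φ hlt.le
    obtain ⟨I, hI, h1, h2⟩ := exists_infinite_subset_pulledFiber hs φ hξ hlt
    exact almostSSubset_of_infinite (hE.subset fun x hx => (h _ hx.1).resolve_left hx.2) hI h1
      (h2 _)

theorem isCoherentFamily_pulledFiber :
    IsCoherentFamily (towerSet (pulledFiber 𝓕 φ)) (towerFun _ (pulledFiber_lt hs φ)) where
  pretower :=
    { orderType := nonempty_orderIso_Omega1Tail
      infinite := fun α => by
        have h0 : (⟨0, Ordinal.omega_pos 1⟩ : Omega1) < α.incl :=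
          Ordinal.omega0_pos.trans_le α.2.1
        obtain ⟨I, hI, h1, -⟩ := exists_infinite_subset_pulledFiber hs φ h0 h0
        exact hI.mono fun x hx => ⟨_, h1 hx⟩
      increasing := fun α β hαβ => by
        have hlt : α.incl < β.incl := hαβ
        obtain ⟨E, hE, h⟩ := exists_finite_pulledFiber_subset hs φ hlt.le
        obtain ⟨I, hI, h1, h2⟩ := exists_infinite_subset_pulledFiber hs φ hlt hlt
        refine almostSSubset_of_infinite (hE.subset ?_) hI (fun x hx => ⟨_, h1 hx⟩) ?_
        · rintro x ⟨⟨ξ, hξ⟩, hx⟩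
          exact (h ξ hξ).resolve_left fun hc => hx ⟨ξ, hc⟩
        · rw [Set.disjoint_left]
          rintro x hx ⟨ξ, hξ⟩
          exact Set.disjoint_left.1 (h2 ξ) hx hξ }
  coherent α β hαβ := by
    have hlt : α.incl < β.incl := hαβ
    obtain ⟨E, hE, h⟩ := exists_finite_pulledFiber_subset hs φ hlt.le
    refine hE.subset ?_
    rintro x ⟨hα, hβ, hne⟩
    obtain ⟨ξ, hξ⟩ := hα
    refine (h ξ hξ).resolve_left fun hx => hne ?_
    exact ((towerFun_eq_iff _ (pulledFiber_unique hs φ) _ ξ).2 hξ).trans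
      ((towerFun_eq_iff _ (pulledFiber_unique hs φ) _ ξ).2 hx).symm

theorem lowerFibers_eq (c : TailPair) (α : Set.Ioi c.1.2) :
    lowerFibers (towerFun _ (pulledFiber_lt hs φ)) c α =
      pulledFiber 𝓕 φ α.1.incl c.1.1.incl :=
  fiber_towerFun _ (pulledFiber_unique hs φ) _ _

theorem upperFibers_eq (c : TailPair) (α : Set.Ioi c.1.2) :
    upperFibers (towerFun _ (pulledFiber_lt hs φ)) c α =
      pulledFiber 𝓕 φ α.1.incl c.1.2.incl :=
  fiber_towerFun _ (pulledFiber_unique hs φ) _ _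

include hc

theorem isGap_pulledFiber [Countable X] (ξ μ : Omega1Tail) (hξμ : ξ < μ) :
    IsGap (fun α : Set.Ioi μ => pulledFiber 𝓕 φ α.1.incl ξ.incl)
      (fun α : Set.Ioi μ => pulledFiber 𝓕 φ α.1.incl μ.incl) where
  pregap :=
    { left := isPretower_pulledFiber hs φ ξ μ hξμ.le
      right := isPretower_pulledFiber hs φ μ μ le_rfl
      inter_eq_empty := fun α => by
        rw [Set.eq_empty_iff_forall_notMem]
        rintro x ⟨h1, h2⟩
        exact hξμ.ne (Omega1Tail.incl_injective (pulledFiber_unique hs φ _ _ _ _ h1 h2)) }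
  not_separated := by
    rintro ⟨C, hC⟩
    -- Record the finite errors of a separating set `C`. If two indices have the same errors, a
    -- point common to a lower and an upper fiber would lie in both fibers of one index.
    let g : Set.Ioi μ → Finset X × Finset X := fun α =>
      (Set.Finite.toFinset (hC α).1, Set.Finite.toFinset (hC α).2)
    obtain ⟨t, ht⟩ := exists_uncountable_fiber (not_countable_Ioi μ) g
    -- With constant value `1`, singletons satisfy their requirement vacuously, and compatibility of
    -- two of them produces a crossing point.
    obtain ⟨p, q, hpq, hgood⟩ := hc.exists_pairGood hs (fun _ _ => 1) (P := {α | g α = t}) ht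
      (fun p => {(ξ.incl, μ.incl, p.1.1.incl)}) (fun p a b c habc => by
        simp only [Finset.mem_singleton, Prod.mk.injEq] at habc
        rw [habc.1, habc.2.1]
        exact hξμ) (fun p a b c d h1 h2 => by
        simp only [Finset.mem_singleton, Prod.mk.injEq] at h1 h2
        exact ⟨fun h => absurd h one_ne_zero, fun _ hne => absurd (h1.2.2.trans h2.2.2.symm) hne⟩)
    have key : ∀ p q : Set.Ioi μ, g p = t → g q = t → ∀ x, x ∈ pulledFiber 𝓕 φ p.1.incl ξ.incl →
        x ∈ pulledFiber 𝓕 φ q.1.incl μ.incl → False := by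
      intro p q hp hq x hx hx'
      have hpq := hp.trans hq.symm
      simp only [g, Prod.mk.injEq] at hpq
      have hne : ξ.incl ≠ μ.incl := fun h => hξμ.ne (Omega1Tail.incl_injective h)
      by_cases hxC : x ∈ C
      · have h1 := hpq.2.symm.subset ((Set.Finite.mem_toFinset _).2 ⟨hx', fun h => h hxC⟩)
        exact hne (pulledFiber_unique hs φ _ _ _ _ hx ((Set.Finite.mem_toFinset _).1 h1).1)
      · have h1 := hpq.1.subset ((Set.Finite.mem_toFinset _).2 ⟨hx, hxC⟩)
        exact hne (pulledFiber_unique hs φ _ _ _ _ ((Set.Finite.mem_toFinset _).1 h1).1 hx')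
    obtain ⟨y, hy⟩ := (hgood ξ.incl μ.incl p.1.1.incl q.1.1.incl (by simp) (by simp)).2
      one_ne_zero fun h => hpq (Subtype.ext (Subtype.ext (Omega1Tail.incl_injective h)))
    obtain ⟨x, rfl⟩ := φ.surjective y
    rcases hy with ⟨h1, h2⟩ | ⟨h1, h2⟩
    · exact key p.1 q.1 p.2 q.2 x h1 h2
    · exact key q.1 p.1 q.2 p.2 x h1 h2

/-- Finite supports turn conditions into finite sets of triples, with the coordinate encoded by its
pair. This one statement serves both finite products and the full finite support product. -/
theorem exists_union_mem_chi {J P : Type*} {γ : J → TailPair} (hγ : Function.Injective γ)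
    (e : J → Fin 2) (hP : ¬ Countable P) (σ : P → ∀ j, Finset (Set.Ioi (γ j).1.2))
    (hfin : ∀ p, {j | σ p j ≠ ∅}.Finite) {A B : ∀ j, Set.Ioi (γ j).1.2 → Set X}
    (hA : ∀ j α, A j α = pulledFiber 𝓕 φ α.1.incl (γ j).1.1.incl)
    (hB : ∀ j α, B j α = pulledFiber 𝓕 φ α.1.incl (γ j).1.2.incl)
    (hσ : ∀ p j, σ p j ∈ if e j = 0 then chiZero (A j) (B j) else chiOne (A j) (B j)) :
    ∃ p q, p ≠ q ∧ ∀ j, σ p j ∪ σ q j ∈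
      if e j = 0 then chiZero (A j) (B j) else chiOne (A j) (B j) := by
  classical
  let tr : P → Finset (Omega1 × Omega1 × Omega1) := fun p => (hfin p).toFinset.biUnion fun j =>
    (σ p j).image fun α => ((γ j).1.1.incl, (γ j).1.2.incl, α.1.incl)
  -- The value `1` off the range of `γ` is arbitrary: no triple involves such a pair.
  let e' : Omega1 → Omega1 → Fin 2 := fun ξ μ =>
    if ∃ j, (γ j).1.1.incl = ξ ∧ (γ j).1.2.incl = μ ∧ e j = 0 then 0 else 1
  have hinj : ∀ {i j}, (γ i).1.1.incl = (γ j).1.1.incl → (γ i).1.2.incl = (γ j).1.2.incl →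
      i = j := fun h1 h2 => hγ (Subtype.ext (Prod.ext (Omega1Tail.incl_injective h1)
        (Omega1Tail.incl_injective h2)))
  have he' : ∀ j, e' (γ j).1.1.incl (γ j).1.2.incl = 0 ↔ e j = 0 := by
    intro j
    have : (∃ i, (γ i).1.1.incl = (γ j).1.1.incl ∧ (γ i).1.2.incl = (γ j).1.2.incl ∧ e i = 0) ↔
        e j = 0 :=
      ⟨fun ⟨i, h1, h2, h3⟩ => hinj h1 h2 ▸ h3, fun h => ⟨j, rfl, rfl, h⟩⟩
    by_cases h : e j = 0 <;> simp [e', this, h]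
  have hv : ∀ j, Function.Injective fun α : Set.Ioi (γ j).1.2 => α.1.incl := fun j α β h =>
    Subtype.ext (Omega1Tail.incl_injective h)
  have hmem : ∀ p ξ μ α, (ξ, μ, α) ∈ tr p ↔ ∃ j, ∃ a ∈ σ p j,
      (γ j).1.1.incl = ξ ∧ (γ j).1.2.incl = μ ∧ a.1.incl = α := by
    intro p ξ μ α
    simp only [tr, Finset.mem_biUnion, Finset.mem_image, Set.Finite.mem_toFinset,
      Set.mem_ofPred_eq, Prod.mk.injEq]
    constructor
    · rintro ⟨j, -, a, ha, h⟩
      exact ⟨j, a, ha, h⟩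
    · rintro ⟨j, a, ha, h⟩
      exact ⟨j, Finset.ne_empty_of_mem ha, a, ha, h⟩
  have hchi : ∀ j (s : Finset (Set.Ioi (γ j).1.2)),
      (s ∈ if e j = 0 then chiZero (A j) (B j) else chiOne (A j) (B j)) ↔
      ∀ a ∈ s, ∀ b ∈ s, PairGood pairingType 𝓕 e' (γ j).1.1.incl (γ j).1.2.incl a.1.incl
        b.1.incl := by
    intro j s
    rw [← mem_chi_iff (hv j) (hA j) (hB j)]
    simp only [he']
  obtain ⟨p, q, hpq, hgood⟩ := hc.exists_pairGood hs e' hP tr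
    (fun p ξ μ α h => by
      obtain ⟨j, a, -, rfl, rfl, -⟩ := (hmem p ξ μ α).1 h
      exact (γ j).2)
    (fun p ξ μ α β h1 h2 => by
      obtain ⟨j, a, ha, rfl, rfl, rfl⟩ := (hmem p ξ μ α).1 h1
      obtain ⟨i, b, hb, h3, h4, rfl⟩ := (hmem p _ _ β).1 h2
      obtain rfl := hinj h3 h4
      exact (hchi _ _).1 (hσ p _) a ha b hb)
  refine ⟨p, q, hpq, fun j => (hchi j _).2 fun a ha b hb => hgood _ _ _ _ ?_ ?_⟩
  · rw [Finset.mem_union, hmem, hmem]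
    exact (Finset.mem_union.1 ha).imp (fun h => ⟨j, a, h, rfl, rfl, rfl⟩)
      fun h => ⟨j, a, h, rfl, rfl, rfl⟩
  · rw [Finset.mem_union, hmem, hmem]
    exact (Finset.mem_union.1 hb).imp (fun h => ⟨j, b, h, rfl, rfl, rfl⟩)
      fun h => ⟨j, b, h, rfl, rfl, rfl⟩

theorem isIndependentFamily_pulledFiber [Countable X] :
    IsIndependentFamily (towerFun _ (pulledFiber_lt hs φ)) where
  gap c := by
    rw [funext (lowerFibers_eq hs φ c), funext (upperFibers_eq hs φ c)]
    exact isGap_pulledFiber hs hc φ _ _ c.2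
  ccc C s := by
    intro S hS
    by_contra hunc
    obtain ⟨p, q, hpq, hr⟩ := exists_union_mem_chi hs hc φ (γ := fun c : C => c.1)
      Subtype.val_injective s (P := S) hunc (fun p j => Chi.support (p.1 j))
      (fun p => Set.toFinite _) (fun j => lowerFibers_eq hs φ j.1)
      (fun j => upperFibers_eq hs φ j.1) (fun p j => (OrderDual.ofDual (p.1 j)).2)
    refine hS p.1 p.2 q.1 q.2 (fun h => hpq (Subtype.ext h))
      ⟨fun j => OrderDual.toDual ⟨_, hr j⟩, fun j => ?_, fun j => ?_⟩
    · exact Finset.subset_union_left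
    · exact Finset.subset_union_right

theorem isCCC_finiteSupportProduct (e : TailPair → Fin 2) :
    IsCCC (FiniteSupportProduct e (lowerFibers (towerFun _ (pulledFiber_lt hs φ)))
      (upperFibers (towerFun _ (pulledFiber_lt hs φ)))) := by
  intro S hS
  by_contra hunc
  obtain ⟨p, q, hpq, hr⟩ := exists_union_mem_chi hs hc φ (γ := id) Function.injective_id e
    (P := S) hunc (fun p j => Chi.support (p.1.1 j)) (fun p => p.1.2) (lowerFibers_eq hs φ)
    (upperFibers_eq hs φ) (fun p j => (OrderDual.ofDual (p.1.1 j)).2)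
  refine hS p.1 p.2 q.1 q.2 (fun h => hpq (Subtype.ext h))
    ⟨⟨fun j => OrderDual.toDual ⟨_, hr j⟩, ?_⟩, fun j => ?_, fun j => ?_⟩
  · refine (p.1.2.union q.1.2).subset fun j hj => ?_
    by_contra hcon
    simp only [Set.mem_union, Set.mem_ofPred_eq, not_or, not_not] at hcon
    apply hj
    show Chi.support (p.1.1 j) ∪ Chi.support (q.1.1 j) = ∅
    rw [hcon.1, hcon.2, Finset.union_empty]
  · exact Finset.subset_union_left
  · exact Finset.subset_union_right

end Family

theorem mainTheorem12 (hFCA : FCA) (X : Type*) [Countable X] [Infinite X] :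
    ∃ (T : Omega1Tail → Set X) (f : ∀ α : Omega1Tail, T α → Set.Iio (α : Ordinal.{0})),
      IsCoherentFamily T f ∧ IsIndependentFamily f ∧
      ∀ e : TailPair → Fin 2,
        IsCCC (FiniteSupportProduct e (lowerFibers f) (upperFibers f)) := by
  obtain ⟨𝓕, hs, hc⟩ := hFCA pairingType
  obtain ⟨φ⟩ : Nonempty (X ≃ SchemePoint) := nonempty_equiv_of_countable
  exact ⟨_, _, isCoherentFamily_pulledFiber hs φ, isIndependentFamily_pulledFiber hs hc φ,
    isCCC_finiteSupportProduct hs hc φ⟩
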